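/- **Setting.** Let $\Sigma$ be a finite non-empty alphabet and $\Sigma^\infty=\Sigma^+\cup\Sigma^\omega$, regarded as an $\omega$-semigroup under concatenation. An $\omega$-semigroup $M=(M_f,M_\omega)$ consists of a semigroup $M_f$, a mixed product $M_f\times M_\omega\to M_\omega$ and an infinite product $M_f^{\mathbb N}\to M_\omega$ satisfying the usual associativity laws; a finite one is represented by the tables of its product, its mixed product and its $\omega$-power $m\mapsto mmm\cdots$, and a morphism $\Sigma^\infty\to M$ is represented by the images of the letters. A language $L\subseteq\Sigma^\omega$ is $\omega$-regular if it is accepted by a nondeterministic Büchi automaton; it is recognised by a morphism $h_L:\Sigma^\infty\to M_L$ and a set $H\subseteq M_{L,\omega}$ if $L=\{\alpha\in\Sigma^\omega: h_L(\alpha)\in H\}$. "Automaton" means nondeterministic Büchi automaton, and "compute" means by an algorithm that is uniform in the representations of the data. A substitution is a non-erasing monoid endomorphism of $\Sigma^*$; $S(\Sigma)$ is the set of all of them. For a letter $a$ write $\sigma(a)=b_1v_1\cdots b_dv_d$ with $b_1,\dots,b_d$ distinct letters and $v_i\in\{b_1,\dots,b_i\}^*$, and for a morphism $h:\Sigma^\infty\to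 M_L$ put $\mathsf{segments}_\sigma(a,h)=\langle(b_1,h(v_1)),\dots,(b_d,h(v_d))\rangle$, where $h(\varepsilon)$ is a fresh neutral element adjoined to $M_{L,f}$. Put $\sigma\equiv_L\mu$ if $\mathsf{segments}_\sigma=\mathsf{segments}_\mu$ (as functions of all letters $a$ and all morphisms $h:\Sigma^\infty\to M_L$); $[\sigma]_L$ is the class of $\sigma$ and $\Xi_L$ the set of classes. For $\hat s=(\sigma_n,a_n)_{n\in\mathbb N}$ over $S(\Sigma)\times\Sigma$ let $\mathsf{trace}_L(\hat s)=([\sigma_n]_L,a_n)_{n\in\mathbb N}$. The sequence $\hat s$ is congenial if $\sigma_{n+1}(a_{n+1})$ begins with $a_n$ for all $n$, and it generates $\alpha\in\Sigma^\infty$ if $\alpha=\lim_{n\to\infty}\sigma_0\cdots\sigma_n(a_n)$, i.e. either $\alpha$ is finite and the sequence of words is eventually equal to $\alpha$, or $\alpha$ is infinite and every finite prefix of $\alpha$ is a prefix of all but finitely many of the words. **Theorem.** 1. Given a Büchi automaton over $\Sigma$ with language $L$, one can compute a finite $\omega$-semigroup $M_L$, a morphism $h_L:\Sigma^\infty\to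 M_L$ and a set $H\subseteq M_{L,\omega}$ that recognise $L$. Now let $L\subseteq\Sigma^\omega$ be any language recognised by a morphism $h_L$ into a finite $\omega$-semigroup $M_L$ and a set $H\subseteq M_{L,\omega}$. From (the representation of) these data one can compute a list consisting of exactly one representative of each class in $\Xi_L$ (so $\Xi_L$ is finite; these representatives are used to write down the letters of automata over $\Xi_L\times\Sigma$), and moreover the following. 2. One can compute an automaton $\mathcal B$ over $\Xi_L\times\Sigma$ such that for every infinite sequence $\hat s$ over $S(\Sigma)\times\Sigma$, $\mathcal B$ accepts $\mathsf{trace}_L(\hat s)$ if and only if $\hat s$ is congenial and generates a word in $L$. 3. Given in addition $x\in M_{L,f}\cup M_{L,\omega}$ (disjoint union), one can compute an automaton $\mathcal B_x$ over $\Xi_L\times\Sigma$ such that for every infinite sequence $\hat s$ over $S(\Sigma)\times\Sigma$, $\mathcal B_x$ accepts $\mathsf{trace}_L(\hat s)$ if and only if $\hat s$ is congenial and $h_L(\alpha)=x$, where $\alpha\in\Sigma^\infty$ is the word generated by $\hat s$. 4. Given in addition a finite set $S\subseteq S(\Sigma)$, one can compute an automaton $\mathcal B$ over $S\times\Sigma$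 such that for every infinite sequence $\hat s$ over $S\times\Sigma$, $\mathcal B$ accepts $\hat s$ if and only if $\hat s$ is congenial and generates a word in $L$. -/

import Mathlib

/-! ## Büchi automata -/

/-- A nondeterministic Büchi automaton over the alphabet `A` with state set `Q`. -/
structure BuchiAutomaton (A Q : Type*) where
  init : Set Q
  step : Set (Q × A × Q)
  acc : Set Q

/-- Some run on `α` visits accepting states infinitely often. -/
def BuchiAutomaton.Accepts {A Q : Type*} (𝓐 : BuchiAutomaton A Q) (α : ℕ → A) : Prop :=
  ∃ r : ℕ → Q, r 0 ∈ 𝓐.init ∧ (∀ n, (r n, α n, r (n + 1)) ∈ 𝓐.step) ∧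
    ∀ N, ∃ n ≥ N, r n ∈ 𝓐.acc

/-! ## ω-semigroups -/

/-- `segProd mul m i l` is the product `m i * m (i+1) * ⋯ * m (i+l)` of `l + 1` factors. -/
def segProd {F : Type*} (mul : F → F → F) (m : ℕ → F) (i : ℕ) : ℕ → F
  | 0 => m i
  | l + 1 => mul (segProd mul m i l) (m (i + l + 1))

/-- For strictly increasing `k`, the sequence of block products
`m 0 ⋯ m (k 0), m (k 0 + 1) ⋯ m (k 1), …`. -/
def blockProd {F : Type*} (mul : F → F → F) (m : ℕ → F) (k : ℕ → ℕ) : ℕ → F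
  | 0 => segProd mul m 0 (k 0)
  | n + 1 => segProd mul m (k n + 1) (k (n + 1) - (k n + 1))

/-- An ω-semigroup with finite part `F` and infinite part `W`. -/
structure OmegaSemigroup (F W : Type*) where
  mul : F → F → F
  mixed : F → W → W
  prod : (ℕ → F) → W
  mul_assoc : ∀ a b c, mul (mul a b) c = mul a (mul b c)
  mixed_assoc : ∀ a b w, mixed (mul a b) w = mixed a (mixed b w)
  prod_blocks : ∀ (m : ℕ → F) (k : ℕ → ℕ), StrictMono k → prod m = prod (blockProd mul m k)
  mixed_prod : ∀ (a : F) (m : ℕ → F),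
    mixed a (prod m) = prod (fun n => Nat.casesOn n a m)

/-- Morphisms of ω-semigroups. -/
structure OmegaHom {F W F' W' : Type*} (M : OmegaSemigroup F W) (N : OmegaSemigroup F' W') where
  fin : F → F'
  inf : W → W'
  map_mul : ∀ a b, fin (M.mul a b) = N.mul (fin a) (fin b)
  map_mixed : ∀ a w, inf (M.mixed a w) = N.mixed (fin a) (inf w)
  map_prod : ∀ m : ℕ → F, inf (M.prod m) = N.prod (fun n => fin (m n))

/-- The action of a morphism on the union of the two sorts. -/
def OmegaHom.app {F W F' W' : Type*} {M : OmegaSemigroup F W} {N : OmegaSemigroup F' W'}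
    (h : OmegaHom M N) : F ⊕ W → F' ⊕ W' :=
  Sum.map h.fin h.inf

/-! ## The ω-semigroup of finite non-empty and infinite words -/

/-- Non-empty finite words. -/
abbrev FinWord (A : Type*) := {w : List A // w ≠ []}

/-- Non-empty finite words together with infinite words. -/
abbrev InftyWord (A : Type*) := FinWord A ⊕ (ℕ → A)

namespace FinWord

variable {A : Type*}

/-- Concatenation. -/
def append (u v : FinWord A) : FinWord A := ⟨u.1 ++ v.1, by simp [u.2]⟩

/-- The infinite word `v α`. -/
def prepend (v : FinWord A) (α : ℕ → A) (i : ℕ) : A :=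
  if h : i < v.1.length then v.1[i] else α (i - v.1.length)

/-- `flat u n` is `u 0 u 1 ⋯ u (n-1)`. -/
def flat (u : ℕ → FinWord A) : ℕ → List A
  | 0 => []
  | n + 1 => flat u n ++ (u n).1

theorem le_length_flat (u : ℕ → FinWord A) (n : ℕ) : n ≤ (flat u n).length := by
  induction n with
  | zero => simp
  | succ n ih =>
    have := List.length_pos_of_ne_nil (u n).2
    simp only [flat, List.length_append]; omega

/-- The infinite concatenation `u 0 u 1 u 2 ⋯`: its letter at position `i` is read off from the
prefix `u 0 ⋯ u i`, which has length at least `i + 1`. -/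
def infConcat (u : ℕ → FinWord A) (i : ℕ) : A :=
  (flat u (i + 1))[i]'(le_length_flat u (i + 1))

theorem flat_getElem?_mono (u : ℕ → FinWord A) {n m : ℕ} (hnm : n ≤ m) {i : ℕ}
    (hi : i < (flat u n).length) : (flat u m)[i]? = (flat u n)[i]? := by
  induction m, hnm using Nat.le_induction with
  | base => rfl
  | succ m hm ih =>
    have : i < (flat u m).length := by
      by_contra hc
      rw [List.getElem?_eq_none (not_lt.mp hc), List.getElem?_eq_getElem hi] at ih
      cases ih
    rw [flat, List.getElem?_append_left this, ih]

theorem flat_getElem? (u : ℕ → FinWord A) {n i : ℕ} (hi : i < (flat u n).length) :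
    (flat u n)[i]? = some (infConcat u i) := by
  have h1 : (flat u (i + 1))[i]? = some (infConcat u i) := by
    rw [infConcat, List.getElem?_eq_getElem]
  rcases le_total n (i + 1) with h | h
  · rw [← flat_getElem?_mono u h hi, h1]
  · rw [flat_getElem?_mono u h (le_length_flat u (i + 1)), h1]

theorem eq_infConcat (u : ℕ → FinWord A) (β : ℕ → A)
    (h : ∀ i, ∃ n, (flat u n)[i]? = some (β i)) : β = infConcat u := by
  funext i
  obtain ⟨n, hn⟩ := h i
  have hi : i < (flat u n).length := by
    by_contra hc
    rw [List.getElem?_eq_none (not_lt.mp hc)] at hn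
    cases hn
  rw [flat_getElem? u hi] at hn
  exact (Option.some.inj hn).symm

theorem flat_segProd (u : ℕ → FinWord A) (i l : ℕ) :
    flat u i ++ (segProd append u i l).1 = flat u (i + l + 1) := by
  induction l with
  | zero => rfl
  | succ l ih =>
    show flat u i ++ ((segProd append u i l).1 ++ (u (i + l + 1)).1) = _
    rw [← List.append_assoc, ih]; rfl

theorem flat_blockProd (u : ℕ → FinWord A) (k : ℕ → ℕ) (hk : StrictMono k) (n : ℕ) :
    flat (blockProd append u k) (n + 1) = flat u (k n + 1) := by
  induction n with
  | zero =>
    have := flat_segProd u 0 (k 0)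
    simpa [flat, blockProd] using this
  | succ n ih =>
    rw [flat, ih, blockProd, flat_segProd]
    have := hk (Nat.lt_succ_self n)
    congr 1; simp only [Nat.succ_eq_add_one] at this; omega

theorem flat_casesOn (a : FinWord A) (u : ℕ → FinWord A) (n : ℕ) :
    flat (fun n => Nat.casesOn n a u) (n + 1) = a.1 ++ flat u n := by
  induction n with
  | zero => simp [flat]
  | succ n ih =>
    rw [flat, ih, flat, List.append_assoc]

theorem infConcat_blockProd (u : ℕ → FinWord A) (k : ℕ → ℕ) (hk : StrictMono k) :
    infConcat u = infConcat (blockProd append u k) := by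
  refine eq_infConcat _ _ fun i => ⟨i + 1, ?_⟩
  have hle := le_length_flat (blockProd append u k) (i + 1)
  rw [flat_blockProd u k hk] at hle ⊢
  exact flat_getElem? u hle

theorem prepend_infConcat (a : FinWord A) (u : ℕ → FinWord A) :
    prepend a (infConcat u) = infConcat (fun n => Nat.casesOn n a u) := by
  refine eq_infConcat _ _ fun i => ⟨i + 2, ?_⟩
  rw [flat_casesOn, prepend]
  split_ifs with h
  · rw [List.getElem?_append_left h, List.getElem?_eq_getElem h]
  · rw [List.getElem?_append_right (not_lt.mp h)]
    refine flat_getElem? u ?_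
    have := le_length_flat u (i + 1)
    omega

theorem prepend_append (a b : FinWord A) (α : ℕ → A) :
    prepend (append a b) α = prepend a (prepend b α) := by
  funext i
  simp only [prepend, append, List.length_append]
  by_cases h1 : i < a.1.length
  · have : i < a.1.length + b.1.length := by omega
    simp [h1, this, List.getElem_append_left]
  · by_cases h2 : i - a.1.length < b.1.length
    · have : i < a.1.length + b.1.length := by omega
      simp [h1, h2, this, List.getElem_append_right (not_lt.mp h1)]
    · have : ¬ i < a.1.length + b.1.length := by omega
      simp [h1, h2, this, Nat.sub_add_eq]

end FinWord

/-- The ω-semigroup of words over `A`, with concatenation. -/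
def wordOmegaSemigroup (A : Type*) : OmegaSemigroup (FinWord A) (ℕ → A) where
  mul := FinWord.append
  mixed := FinWord.prepend
  prod := FinWord.infConcat
  mul_assoc _ _ _ := Subtype.ext (List.append_assoc _ _ _)
  mixed_assoc := FinWord.prepend_append
  prod_blocks := FinWord.infConcat_blockProd
  mixed_prod := FinWord.prepend_infConcat

/-- Morphisms from the words over `A` into the ω-semigroup `M`. -/
abbrev WordHom (A : Type*) {F W : Type*} (M : OmegaSemigroup F W) :=
  OmegaHom (wordOmegaSemigroup A) M

/-- The language `L` of infinite words is the preimage of `H` under `h`. -/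
def Recognises {A F W : Type*} {M : OmegaSemigroup F W} (h : WordHom A M) (H : Set W)
    (L : Set (ℕ → A)) : Prop :=
  ∀ α, α ∈ L ↔ h.inf α ∈ H

/-- The value of a possibly empty word in `F` with a fresh neutral element adjoined. -/
def WordHom.eval {A F W : Type*} {M : OmegaSemigroup F W} (h : WordHom A M) :
    List A → WithOne F
  | [] => 1
  | a :: w => ((h.fin ⟨a :: w, List.cons_ne_nil a w⟩ : F) : WithOne F)

/-! ## Substitutions, congenial sequences, generated words -/

/-- A substitution: a non-erasing morphism of the free monoid over `A`. -/
structure Substitution (A : Type*) where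
  toHom : FreeMonoid A →* FreeMonoid A
  nonerasing : ∀ v, toHom v = 1 ↔ v = 1

/-- The image of a letter, as a list. -/
def Substitution.image {A : Type*} (σ : Substitution A) (a : A) : List A :=
  (σ.toHom (FreeMonoid.of a)).toList

/-- The composition `σ 0 ∘ σ 1 ∘ ⋯ ∘ σ n`. -/
def composeUpTo {A : Type*} (σ : ℕ → Substitution A) : ℕ → (FreeMonoid A →* FreeMonoid A)
  | 0 => (σ 0).toHom
  | n + 1 => (composeUpTo σ n).comp (σ (n + 1)).toHom

/-- `α` is the limit of the sequence `u` of finite words: either `u` is eventually equal to the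
finite word `α`, or `α` is infinite and every prefix of `α` is eventually a prefix of `u n`. -/
def IsWordLimit {A : Type*} (u : ℕ → List A) : InftyWord A → Prop
  | Sum.inl v => ∃ N, ∀ n ≥ N, u n = v.1
  | Sum.inr β => ∀ j, ∃ N, ∀ n ≥ N, (u n).take j = List.ofFn (fun i : Fin j => β i)

/-- `σ (n+1) (a (n+1))` begins with `a n` for all `n`. -/
def Congenial {A : Type*} (s : ℕ → Substitution A × A) : Prop :=
  ∀ n, [(s n).2] <+: (s (n + 1)).1.image (s (n + 1)).2

/-- `α` is the limit of `σ 0 ⋯ σ n (a n)`. -/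
def Generates {A : Type*} (s : ℕ → Substitution A × A) (α : InftyWord A) : Prop :=
  IsWordLimit
    (fun n => (composeUpTo (fun i => (s i).1) n (FreeMonoid.of (s n).2)).toList) α

/-! ## Equivalence of substitutions -/

/-- Auxiliary function for `firstOccurrences`: given the set of letters seen so far, split a word
into its longest prefix over `seen` and the segments that follow. -/
def splitSeen {A : Type*} [DecidableEq A] (seen : Finset A) :
    List A → List A × List (A × List A)
  | [] => ([], [])
  | b :: w =>
    if b ∈ seen then (b :: (splitSeen seen w).1, (splitSeen seen w).2)
    else ([], (b, (splitSeen (insert b seen) w).1) :: (splitSeen (insert b seen) w).2)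

/-- The factorisation `b₁ v₁ ⋯ b_d v_d` of a word at the first occurrences of its letters, as the
list of the pairs `(bᵢ, vᵢ)`: the `bᵢ` are distinct and `vᵢ` is a word over `b₁, …, bᵢ`. -/
def firstOccurrences {A : Type*} [DecidableEq A] (w : List A) : List (A × List A) :=
  (splitSeen ∅ w).2

/-- The pairs `(bᵢ, h(vᵢ))` for the first-occurrence factorisation of `σ(a)`. -/
def segments {A F W : Type*} [DecidableEq A] {M : OmegaSemigroup F W} (σ : Substitution A)
    (a : A) (h : WordHom A M) : List (A × WithOne F) :=
  (firstOccurrences (σ.image a)).map fun p => (p.1, WordHom.eval h p.2)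

/-- Substitutions are equivalent if they have the same segments for all letters and all morphisms
into `M`. -/
def substSetoid (A : Type*) [DecidableEq A] {F W : Type*} (M : OmegaSemigroup F W) :
    Setoid (Substitution A) where
  r σ μ := ∀ (a : A) (h : WordHom A M), segments σ a h = segments μ a h
  iseqv := ⟨fun _ _ _ => rfl, fun h a g => (h a g).symm, fun h h' a g => (h a g).trans (h' a g)⟩

/-- The set of equivalence classes of substitutions modulo `M`. -/
abbrev Xi (A : Type*) [DecidableEq A] {F W : Type*} (M : OmegaSemigroup F W) :=
  Quotient (substSetoid A M)

/-- The class of a substitution. -/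
def Substitution.cls {A : Type*} [DecidableEq A] {F W : Type*} (M : OmegaSemigroup F W)
    (σ : Substitution A) : Xi A M :=
  Quotient.mk (substSetoid A M) σ

/-- The trace of a sequence of pairs of a substitution and a letter. -/
def trace {A : Type*} [DecidableEq A] {F W : Type*} (M : OmegaSemigroup F W)
    (s : ℕ → Substitution A × A) : ℕ → Xi A M × A :=
  fun n => ((s n).1.cls M, (s n).2)

/-! ## Finite representations

All representations are made of natural numbers, booleans, pairs, sums and lists. Alphabets, state
sets and finite ω-semigroups have carriers of the form `{0, …, n-1}`. -/

/-- Number of states, list of initial states, list of transitions, list of accepting states;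
letters are represented by elements of `C`. Every such tuple represents an automaton. -/
abbrev BuchiCode (C : Type) := ℕ × List ℕ × List (ℕ × C × ℕ) × List ℕ

/-- The automaton over `A` given by a code, where the letter `a` is represented by `enc a`. -/
def BuchiCode.automaton {A : Type*} {C : Type} (c : BuchiCode C) (enc : A → C) :
    BuchiAutomaton A (Fin c.1) where
  init := {q | (q : ℕ) ∈ c.2.1}
  step := {t | ((t.1 : ℕ), enc t.2.1, (t.2.2 : ℕ)) ∈ c.2.2.1}
  acc := {q | (q : ℕ) ∈ c.2.2.2}

/-- Representation of a substitution by the list of the images of the letters. -/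
abbrev SubstCode := List (List ℕ)

def Substitution.code {k : ℕ} (σ : Substitution (Fin k)) : SubstCode :=
  List.ofFn fun a => (σ.image a).map Fin.val

/-- Alphabet size; sizes of the two sorts; tables of the product, of the mixed product and of
the ω-power; images of the letters. -/
abbrev HomCode := ℕ × (ℕ × ℕ) × List (List ℕ) × List (List ℕ) × List ℕ × List ℕ

/-- Representation of a morphism from words into a finite ω-semigroup. The infinite product is
represented by the ω-power `m ↦ m m m ⋯` only, and the morphism by the images of the letters. -/
def OmegaHom.code {k nf nw : ℕ} {M : OmegaSemigroup (Fin nf) (Fin nw)}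
    (h : WordHom (Fin k) M) : HomCode :=
  (k, (nf, nw),
    List.ofFn fun a => List.ofFn fun b => (M.mul a b : ℕ),
    List.ofFn fun a => List.ofFn fun w => (M.mixed a w : ℕ),
    List.ofFn fun a => (M.prod (fun _ => a) : ℕ),
    List.ofFn fun i => (h.fin ⟨[i], List.cons_ne_nil i []⟩ : ℕ))

/-- Representation of a subset of `{0, …, n-1}` by its characteristic function. -/
def finsetCode {n : ℕ} (H : Finset (Fin n)) : List Bool :=
  List.ofFn fun w => decide (w ∈ H)

/-- Representation of an element of the disjoint union of the two sorts. -/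
def sumCode {nf nw : ℕ} : Fin nf ⊕ Fin nw → ℕ ⊕ ℕ :=
  Sum.map Fin.val Fin.val

/-! ## Primitive recursive functions, in a form suited to `fun_prop` -/

attribute [fun_prop] Primrec Primrec.const Primrec.comp

namespace Primrec

section

variable {α β γ σ : Type*} [Primcodable α] [Primcodable β] [Primcodable γ] [Primcodable σ]

@[fun_prop] theorem fun_id : Primrec (fun a : α => a) := Primrec.id

@[fun_prop] theorem fun_mk {f : α → β} {g : α → γ} (hf : Primrec f) (hg : Primrec g) :
    Primrec fun a => (f a, g a) := hf.pair hg

@[fun_prop] theorem fun_fst {f : α → β × γ} (hf : Primrec f) : Primrec fun a => (f a).1 :=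
  Primrec.fst.comp hf

@[fun_prop] theorem fun_snd {f : α → β × γ} (hf : Primrec f) : Primrec fun a => (f a).2 :=
  Primrec.snd.comp hf

@[fun_prop] theorem fun_add {f g : α → ℕ} (hf : Primrec f) (hg : Primrec g) :
    Primrec fun a => f a + g a := Primrec.nat_add.comp hf hg

@[fun_prop] theorem fun_natRec {f : α → σ} {n : α → ℕ} {g : α → ℕ → σ → σ} (hf : Primrec f)
    (hn : Primrec n) (hg : Primrec fun p : α × ℕ × σ => g p.1 p.2.1 p.2.2) :
    Primrec fun a => Nat.rec (motive := fun _ => σ) (f a) (g a) (n a) :=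
  Primrec.nat_rec' (h := fun a p => g a p.1 p.2) hn hf hg

@[fun_prop] theorem fun_encode {f : α → β} (hf : Primrec f) :
    Primrec fun a => Encodable.encode (f a) := Primrec.encode.comp hf

@[fun_prop] theorem fun_decide_eq [DecidableEq β] {f g : α → β} (hf : Primrec f)
    (hg : Primrec g) : Primrec fun a => decide (f a = g a) := (Primrec.eq.comp hf hg).decide

@[fun_prop] theorem fun_decide_le {f g : α → ℕ} (hf : Primrec f) (hg : Primrec g) :
    Primrec fun a => decide (f a ≤ g a) := (Primrec.nat_le.comp hf hg).decide

@[fun_prop] theorem fun_and {f g : α → Bool} (hf : Primrec f) (hg : Primrec g) :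
    Primrec fun a => f a && g a := Primrec.and.comp hf hg

@[fun_prop] theorem fun_or {f g : α → Bool} (hf : Primrec f) (hg : Primrec g) :
    Primrec fun a => f a || g a := Primrec.or.comp hf hg

@[fun_prop] theorem fun_cond {c : α → Bool} {f g : α → σ} (hc : Primrec c) (hf : Primrec f)
    (hg : Primrec g) : Primrec fun a => bif c a then f a else g a := Primrec.cond hc hf hg

@[fun_prop] theorem fun_some {f : α → β} (hf : Primrec f) : Primrec fun a => some (f a) :=
  Primrec.option_some.comp hf

@[fun_prop] theorem fun_optionGetD {f : α → Option β} {g : α → β} (hf : Primrec f)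
    (hg : Primrec g) : Primrec fun a => (f a).getD (g a) := Primrec.option_getD.comp hf hg

@[fun_prop] theorem fun_elim {o : α → Option β} {f : α → σ} {g : α → β → σ} (ho : Primrec o)
    (hf : Primrec f) (hg : Primrec fun p : α × β => g p.1 p.2) :
    Primrec fun a => (o a).elim (f a) (g a) :=
  (Primrec.option_casesOn (g := g) ho hf hg).of_eq fun a => by cases o a <;> rfl

@[fun_prop] theorem fun_sumElim {o : α → β ⊕ γ} {f : α → β → σ} {g : α → γ → σ} (ho : Primrec o)
    (hf : Primrec fun p : α × β => f p.1 p.2) (hg : Primrec fun p : α × γ => g p.1 p.2) :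
    Primrec fun a => Sum.elim (f a) (g a) (o a) :=
  (Primrec.sumCasesOn (g := f) (h := g) ho hf hg).of_eq fun a => by cases o a <;> rfl

@[fun_prop] theorem fun_cons {f : α → β} {g : α → List β} (hf : Primrec f) (hg : Primrec g) :
    Primrec fun a => f a :: g a := Primrec.list_cons.comp hf hg

@[fun_prop] theorem fun_range {f : α → ℕ} (hf : Primrec f) : Primrec fun a => List.range (f a) :=
  Primrec.list_range.comp hf

@[fun_prop] theorem fun_length {f : α → List β} (hf : Primrec f) : Primrec fun a => (f a).length :=
  Primrec.list_length.comp hf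

@[fun_prop] theorem fun_tail {f : α → List β} (hf : Primrec f) : Primrec fun a => (f a).tail :=
  Primrec.list_tail.comp hf

@[fun_prop] theorem fun_headOption {f : α → List β} (hf : Primrec f) :
    Primrec fun a => (f a).head? :=
  Primrec.list_head?.comp hf

@[fun_prop] theorem fun_listGetD {f : α → List β} {g : α → ℕ} (d : β) (hf : Primrec f)
    (hg : Primrec g) : Primrec fun a => (f a).getD (g a) d := (Primrec.list_getD d).comp hf hg

@[fun_prop] theorem fun_idxOf [BEq β] [LawfulBEq β] {f : α → List β} {g : α → β}
    (hf : Primrec f) (hg : Primrec g) : Primrec fun a => (f a).idxOf (g a) := by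
  have h : Primrec₂ fun a b => b == g a := by
    classical
    have h' : Primrec fun p : α × β => decide (p.2 = g p.1) := by fun_prop
    exact h'.of_eq fun p => by rw [Bool.eq_iff_iff, beq_iff_eq, decide_eq_true_eq]
  exact Primrec.list_findIdx hf h

@[fun_prop] theorem fun_foldl {f : α → List β} {g : α → σ} {h : α → σ → β → σ} (hf : Primrec f)
    (hg : Primrec g) (hh : Primrec fun p : α × σ × β => h p.1 p.2.1 p.2.2) :
    Primrec fun a => (f a).foldl (h a) (g a) :=
  Primrec.list_foldl (h := fun a p => h a p.1 p.2) hf hg hh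

@[fun_prop] theorem fun_foldr {f : α → List β} {g : α → σ} {h : α → β → σ → σ} (hf : Primrec f)
    (hg : Primrec g) (hh : Primrec fun p : α × β × σ => h p.1 p.2.1 p.2.2) :
    Primrec fun a => (f a).foldr (h a) (g a) :=
  Primrec.list_foldr (h := fun a p => h a p.1 p.2) hf hg hh

@[fun_prop] theorem fun_map {f : α → List β} {g : α → β → σ} (hf : Primrec f)
    (hg : Primrec fun p : α × β => g p.1 p.2) : Primrec fun a => (f a).map (g a) :=
  Primrec.list_map hf hg

@[fun_prop] theorem fun_flatMap {f : α → List β} {g : α → β → List σ} (hf : Primrec f)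
    (hg : Primrec fun p : α × β => g p.1 p.2) : Primrec fun a => (f a).flatMap (g a) :=
  Primrec.list_flatMap hf hg

@[fun_prop] theorem fun_filter {f : α → List β} {p : α → β → Bool} (hf : Primrec f)
    (hp : Primrec fun q : α × β => p q.1 q.2) : Primrec fun a => (f a).filter (p a) := by
  have : Primrec fun a => (f a).flatMap fun b => bif p a b then [b] else [] := by fun_prop
  refine this.of_eq fun a => ?_
  induction f a with
  | nil => rfl
  | cons b l ih => cases h : p a b <;> simp [h, ih]

@[fun_prop] theorem fun_any {f : α → List β} {p : α → β → Bool} (hf : Primrec f)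
    (hp : Primrec fun q : α × β => p q.1 q.2) : Primrec fun a => (f a).any (p a) := by
  have : Primrec fun a => (f a).foldr (fun b s => p a b || s) false := by fun_prop
  refine this.of_eq fun a => ?_
  induction f a with
  | nil => rfl
  | cons b l ih => simp only [List.foldr_cons, List.any_cons, ih]

@[fun_prop] theorem fun_decide_mem [BEq β] [LawfulBEq β] {f : α → β} {g : α → List β}
    (hf : Primrec f) (hg : Primrec g) : Primrec fun a => decide (f a ∈ g a) := by
  classical
  have : Primrec fun a => (g a).any fun b => decide (f a = b) := by fun_prop
  refine this.of_eq fun a => ?_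
  rw [Bool.eq_iff_iff, List.any_eq_true]
  simp only [decide_eq_true_eq]
  exact ⟨fun ⟨b, hb, h⟩ => h ▸ hb, fun h => ⟨_, h, rfl⟩⟩

end

end Primrec

/-! ## Enumerations and finite sets -/

/-- All lists of length `n` with entries from `l`. -/
def tuples {α : Type*} (l : List α) (n : ℕ) : List (List α) :=
  Nat.rec [[]] (fun _ t => t.flatMap fun w => l.map fun b => b :: w) n

theorem mem_tuples {α : Type*} {l : List α} {n : ℕ} {w : List α} :
    w ∈ tuples l n ↔ w.length = n ∧ ∀ x ∈ w, x ∈ l := by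
  induction n generalizing w with
  | zero => simp +contextual [tuples, List.length_eq_zero_iff]
  | succ n ih =>
    have : tuples l (n + 1) = (tuples l n).flatMap fun w => l.map fun b => b :: w := rfl
    simp only [this, List.mem_flatMap, List.mem_map, ih]
    constructor
    · rintro ⟨v, ⟨rfl, hv⟩, b, hb, rfl⟩
      simpa [hb] using hv
    · rintro ⟨hl, hw⟩
      cases w with
      | nil => simp at hl
      | cons b v => exact ⟨v, ⟨by simpa using hl, fun x hx => hw x (by simp [hx])⟩, b,
          hw b (by simp), rfl⟩

theorem tuples_nodup {α : Type*} {l : List α} (hl : l.Nodup) (n : ℕ) : (tuples l n).Nodup := by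
  induction n with
  | zero => simp [tuples]
  | succ n ih =>
    have : tuples l (n + 1) = (tuples l n).flatMap fun w => l.map fun b => b :: w := rfl
    rw [this, List.nodup_flatMap]
    refine ⟨fun w _ => hl.map fun a b h => (List.cons.inj h).1, ih.imp fun {w v} hne => ?_⟩
    simp only [Function.onFun, List.disjoint_left, List.mem_map]
    rintro _ ⟨a, _, rfl⟩ ⟨b, _, h⟩
    exact hne (List.cons.inj h).2.symm

@[fun_prop] theorem tuples_primrec {α β : Type*} [Primcodable α] [Primcodable β]
    {f : α → List β} {n : α → ℕ} (hf : Primrec f) (hn : Primrec n) :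
    Primrec fun a => tuples (f a) (n a) := by
  unfold tuples; fun_prop

/-- Keep one pair for each key. -/
def dedupKeys {κ β : Type*} [DecidableEq κ] (l : List (κ × β)) : List (κ × β) :=
  l.foldr (fun p acc => bif acc.any (fun q => decide (q.1 = p.1)) then acc else p :: acc) []

@[fun_prop] theorem dedupKeys_primrec {α κ β : Type*} [Primcodable α] [Primcodable κ]
    [DecidableEq κ] [Primcodable β] {f : α → List (κ × β)} (hf : Primrec f) :
    Primrec fun a => dedupKeys (f a) := by
  unfold dedupKeys; fun_prop

theorem dedupKeys_spec {κ β : Type*} [DecidableEq κ] (l : List (κ × β)) :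
    (∀ p ∈ dedupKeys l, p ∈ l) ∧ ((dedupKeys l).map Prod.fst).Nodup ∧
      ∀ p ∈ l, p.1 ∈ (dedupKeys l).map Prod.fst := by
  induction l with
  | nil => simp [dedupKeys]
  | cons p l ih =>
    obtain ⟨h1, h2, h3⟩ := ih
    have hc : dedupKeys (p :: l) =
        bif (dedupKeys l).any (fun q => decide (q.1 = p.1)) then dedupKeys l
        else p :: dedupKeys l := rfl
    cases hb : (dedupKeys l).any (fun q => decide (q.1 = p.1)) with
    | true =>
      rw [hb, cond_true] at hc
      rw [hc]
      refine ⟨fun q hq => List.mem_cons_of_mem _ (h1 q hq), h2, fun q hq => ?_⟩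
      rcases List.mem_cons.1 hq with rfl | hq
      · simpa [List.any_eq_true] using hb
      · exact h3 q hq
    | false =>
      rw [hb, cond_false] at hc
      rw [hc]
      refine ⟨fun q hq => ?_, ?_, fun q hq => ?_⟩
      · rcases List.mem_cons.1 hq with rfl | hq
        · simp
        · exact List.mem_cons_of_mem _ (h1 q hq)
      · rw [List.map_cons, List.nodup_cons]
        refine ⟨fun hm => ?_, h2⟩
        obtain ⟨q, hq, hqp⟩ := List.mem_map.1 hm
        have := List.any_eq_false.1 hb q hq
        simp [hqp] at this
      · rcases List.mem_cons.1 hq with rfl | hq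
        · simp
        · exact List.mem_cons_of_mem _ (h3 q hq)

/-- The number of codes of subsets of the set enumerated by `U`. -/
def setCount {α : Type*} (U : List α) : ℕ := (tuples [false, true] U.length).length

/-- The code of the subset `{t ∈ U | φ t}`. -/
def setCode {α : Type*} (U : List α) (φ : α → Bool) : ℕ :=
  (tuples [false, true] U.length).idxOf (U.map φ)

/-- Membership in a coded subset of `U`. -/
def memCode {α : Type*} [DecidableEq α] (U : List α) (x : ℕ) (t : α) : Bool :=
  ((tuples [false, true] U.length).getD x []).getD (U.idxOf t) false

section

variable {α β : Type*} [Primcodable α] [Primcodable β]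

@[fun_prop] theorem setCount_primrec {U : α → List β} (hU : Primrec U) :
    Primrec fun a => setCount (U a) := by
  unfold setCount; fun_prop

@[fun_prop] theorem setCode_primrec {U : α → List β} {φ : α → β → Bool} (hU : Primrec U)
    (hφ : Primrec fun p : α × β => φ p.1 p.2) : Primrec fun a => setCode (U a) (φ a) := by
  unfold setCode; fun_prop

@[fun_prop] theorem memCode_primrec [DecidableEq β] {U : α → List β} {x : α → ℕ} {t : α → β}
    (hU : Primrec U) (hx : Primrec x) (ht : Primrec t) :
    Primrec fun a => memCode (U a) (x a) (t a) := by
  unfold memCode; fun_prop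

end

section

variable {α : Type*} {U : List α}

theorem map_mem_tuples_bool (U : List α) (φ : α → Bool) :
    U.map φ ∈ tuples [false, true] U.length := by
  rw [mem_tuples]
  exact ⟨by simp, fun x _ => by cases x <;> simp⟩

theorem setCode_lt (U : List α) (φ : α → Bool) : setCode U φ < setCount U :=
  List.idxOf_lt_length_iff.2 (map_mem_tuples_bool U φ)

variable [DecidableEq α]

theorem memCode_setCode (φ : α → Bool) {t : α} (ht : t ∈ U) :
    memCode U (setCode U φ) t = φ t := by
  have h : (tuples [false, true] U.length).getD (setCode U φ) [] = U.map φ := by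
    rw [List.getD_eq_getElem _ _ (setCode_lt U φ)]
    exact List.getElem_idxOf _
  have hi : U.idxOf t < U.length := List.idxOf_lt_length_iff.2 ht
  rw [memCode, h, List.getD_eq_getElem _ _ (by simpa using hi)]
  simp

theorem mem_of_memCode {x : ℕ} {t : α} (h : memCode U x t = true) : t ∈ U := by
  by_contra ht
  have hi : U.idxOf t = U.length := List.idxOf_eq_length ht
  rw [memCode, hi] at h
  have hl : ((tuples [false, true] U.length).getD x []).length ≤ U.length := by
    by_cases hx : x < (tuples [false, true] U.length).length
    · rw [List.getD_eq_getElem _ _ hx]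
      exact (mem_tuples.1 (List.getElem_mem hx)).1.le
    · rw [List.getD_eq_default _ _ (not_lt.1 hx)]; simp
  rw [List.getD_eq_default _ _ hl] at h
  cases h

theorem memCode_setCode_iff (φ : α → Bool) {t : α} :
    memCode U (setCode U φ) t = true ↔ t ∈ U ∧ φ t = true := by
  constructor
  · intro h
    have ht := mem_of_memCode h
    exact ⟨ht, by rwa [memCode_setCode φ ht] at h⟩
  · rintro ⟨ht, h⟩
    rwa [memCode_setCode φ ht]

theorem memCode_ext (hU : U.Nodup) {x y : ℕ} (hx : x < setCount U) (hy : y < setCount U)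
    (h : ∀ t, memCode U x t = true ↔ memCode U y t = true) : x = y := by
  have key : ∀ z (hz : z < setCount U), (tuples [false, true] U.length)[z] =
      U.map (memCode U z) := by
    intro z hz
    have hl := (mem_tuples.1 (List.getElem_mem hz)).1
    refine List.ext_getElem (by simpa using hl) fun i hi hi' => ?_
    have hi2 : i < U.length := by simpa using hi'
    rw [List.getElem_map, memCode, List.getD_eq_getElem _ _ hz, hU.idxOf_getElem i hi2,
      List.getD_eq_getElem _ _ hi]
  have hxy : (tuples [false, true] U.length)[x] = (tuples [false, true] U.length)[y] := by
    rw [key x hx, key y hy]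
    exact List.map_congr_left fun t _ => Bool.eq_iff_iff.2 (h t)
  exact (List.Nodup.getElem_inj_iff (tuples_nodup (by simp) _)).1 hxy

end

/-! ## The algorithms -/

/-- The value of a word in a finite semigroup given by its table `t`, where the letters have the
values `f`, multiplied from the left by `acc`; here `none` is a neutral element. -/
def evalTable (t : List (List ℕ)) (f : List ℕ) (acc : Option ℕ) (w : List ℕ) : Option ℕ :=
  w.foldl (fun acc b => some (acc.elim (f.getD b 0) fun x => (t.getD x []).getD (f.getD b 0) 0)) acc

/-- The segments of a word, in reverse order. -/
def segmentsTable (t : List (List ℕ)) (f : List ℕ) (w : List ℕ) : List (ℕ × Option ℕ) :=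
  w.foldl (fun acc b =>
    bif acc.any fun p => decide (p.1 = b) then
      ((acc.head?.getD (0, none)).1, evalTable t f (acc.head?.getD (0, none)).2 [b]) :: acc.tail
    else (b, none) :: acc) []

namespace HomCode

def letterCount (c : HomCode) : ℕ := c.1
def finCount (c : HomCode) : ℕ := c.2.1.1
def infCount (c : HomCode) : ℕ := c.2.1.2
def mulTable (c : HomCode) : List (List ℕ) := c.2.2.1
def mixedTable (c : HomCode) : List (List ℕ) := c.2.2.2.1
def powTable (c : HomCode) : List ℕ := c.2.2.2.2.1
def letters (c : HomCode) : List ℕ := c.2.2.2.2.2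

/-- All assignments of values to letters. -/
def assignments (c : HomCode) : List (List ℕ) := tuples (List.range c.finCount) c.letterCount

/-- The segments of a word for all assignments of values to letters. -/
def wordSignature (c : HomCode) (w : List ℕ) : List (List (ℕ × Option ℕ)) :=
  c.assignments.map fun f => segmentsTable c.mulTable f w

/-- All elements of the finite part with a neutral element adjoined. -/
def optElements (c : HomCode) : List (Option ℕ) := none :: (List.range c.finCount).map some

/-- A list that contains all lists of segments. -/
def segmentLists (c : HomCode) : List (List (ℕ × Option ℕ)) :=
  (List.range (c.letterCount + 1)).flatMap fun d =>
    tuples ((List.range c.letterCount).flatMap fun b => c.optElements.map fun o => (b, o)) d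

/-- An upper bound for the number of signatures of words. -/
def signatureBound (c : HomCode) : ℕ := (tuples c.segmentLists c.assignments.length).length

/-- Non-empty words of bounded length that represent all signatures of non-empty words. -/
def shortWords (c : HomCode) : List (List ℕ) :=
  ((List.range (c.signatureBound + 1)).flatMap fun l =>
    tuples (List.range c.letterCount) l).filter fun w => decide (1 ≤ w.length)

/-- Representatives of the classes of substitutions. -/
def representatives (c : HomCode) : List SubstCode :=
  (dedupKeys ((tuples c.shortWords c.letterCount).map fun s =>
    (s.map fun w => c.wordSignature w, s))).map fun p => p.2

end HomCode

/-- The automaton with the given states, letters, initial states, transitions and accepting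
states. -/
def buchiOf {X C : Type} [Encodable X] (states : List X) (letters : List C) (init : X → Bool)
    (step : X → C → X → Bool) (acc : X → Bool) : BuchiCode C :=
  (states.foldr (fun x n => Encodable.encode x + n) 1,
    (states.filter init).map fun x => Encodable.encode x,
    states.flatMap fun x => letters.flatMap fun l =>
      (states.filter (step x l)).map fun y => (Encodable.encode x, l, Encodable.encode y),
    (states.filter acc).map fun x => Encodable.encode x)

/-- States of the automata that evaluate generated words: the values of the letters under the
composition of the substitutions read so far; the last letter read; the phase; an element of the
finite part; a partial product. -/
abbrev EvalState := List ℕ × ℕ × ℕ × ℕ × Option ℕ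

/-- Transitions between the phases, the word `w` being appended to the word generated so far; `f`
gives the values of the letters.
Phase `0` collects the value of the generated word, phase `1` guesses that the word is complete,
and phases `2` and `3` look for factors of value `e`, phase `3` being entered whenever a factor is
complete. -/
def phaseStep (c : HomCode) (T : List ℕ × List ℕ) (f w : List ℕ) (m m' : ℕ × ℕ × Option ℕ) : Bool :=
  (decide (m.1 = 0) && decide (m'.1 = 0) &&
    decide (some m'.2.1 = evalTable c.mulTable f (some m.2.1) w)) ||
  (decide (m.1 ≤ 1) && decide (m'.1 = 1) && decide (w = []) && decide (m.2.1 ∈ T.1) &&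
    decide (m'.2.1 = m.2.1)) ||
  (decide (m.1 = 0) && decide (m'.1 = 2) && decide (m'.2.2 = none) &&
    decide ((c.mixedTable.getD ((evalTable c.mulTable f (some m.2.1) w).getD 0) []).getD
      (c.powTable.getD m'.2.1 0) 0 ∈ T.2)) ||
  (decide (2 ≤ m.1) && decide (m'.1 = 2) && decide (m'.2.1 = m.2.1) &&
    decide (m'.2.2 = evalTable c.mulTable f m.2.2 w)) ||
  (decide (2 ≤ m.1) && decide (m'.1 = 3) && decide (m'.2.1 = m.2.1) && decide (m'.2.2 = none) &&
    decide (evalTable c.mulTable f m.2.2 w = some m.2.1))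

def evalStates (c : HomCode) : List EvalState :=
  c.assignments.flatMap fun f => (List.range c.letterCount).flatMap fun a =>
    (List.range 4).flatMap fun t => (List.range c.finCount).flatMap fun e =>
      c.optElements.map fun o => (f, a, t, e, o)

/-- In an initial state, the first letter of the generated word is guessed. -/
def evalInit (c : HomCode) (x : EvalState) : Bool :=
  decide (x.1 = c.letters) && decide (x.2.2.1 = 0) &&
    decide (x.2.2.2.1 = c.letters.getD x.2.1 0)

def evalStep (c : HomCode) (T : List ℕ × List ℕ) (x : EvalState) (l : SubstCode × ℕ)
    (y : EvalState) : Bool :=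
  decide ((l.1.getD l.2 []).head? = some x.2.1) &&
  decide (y.1 = l.1.map fun w => (evalTable c.mulTable x.1 none w).getD 0) &&
  decide (y.2.1 = l.2) && phaseStep c T x.1 (l.1.getD l.2 []).tail x.2.2 y.2.2

def evalAcc (x : EvalState) : Bool := decide (x.2.2.1 = 1) || decide (x.2.2.1 = 3)

/-- An automaton that reads sequences of pairs of a substitution from `S` and a letter, and accepts
if the value of the generated word is in the set of targets `T`. -/
def evalAutomaton (c : HomCode) (T : List ℕ × List ℕ) (S : List SubstCode) :
    BuchiCode (SubstCode × ℕ) :=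
  buchiOf (evalStates c) (S.flatMap fun s => (List.range c.letterCount).map fun a => (s, a))
    (evalInit c) (evalStep c T) evalAcc

def langTargets (p : HomCode × List Bool) : List ℕ × List ℕ :=
  ([], (List.range p.1.infCount).filter fun w => p.2.getD w false)

def elementTargets (x : ℕ ⊕ ℕ) : List ℕ × List ℕ :=
  Sum.elim (fun p => ([p], [])) (fun w => ([], [w])) x

def langAutomaton (p : HomCode × List Bool) : BuchiCode (SubstCode × ℕ) :=
  evalAutomaton p.1 (langTargets p) p.1.representatives

def elementAutomaton (p : HomCode × (ℕ ⊕ ℕ)) : BuchiCode (SubstCode × ℕ) :=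
  evalAutomaton p.1 (elementTargets p.2) p.1.representatives

def substAutomaton (p : (HomCode × List Bool) × List SubstCode) : BuchiCode (SubstCode × ℕ) :=
  evalAutomaton p.1.1 (langTargets p.1) p.2

/-- Triples of two states and a flag. -/
def flaggedPairs (n : ℕ) : List (ℕ × ℕ × Bool) :=
  (List.range n).flatMap fun p => (List.range n).flatMap fun q => [false, true].map fun b => (p, q, b)

def relMul (n x y : ℕ) : ℕ :=
  setCode (flaggedPairs n) fun t => (List.range n).any fun r => [false, true].any fun b =>
    [false, true].any fun b' => memCode (flaggedPairs n) x (t.1, r, b) &&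
      memCode (flaggedPairs n) y (r, t.2.1, b') && decide (t.2.2 = (b || b'))

def relMixed (n x w : ℕ) : ℕ :=
  setCode (List.range n) fun p => (List.range n).any fun q => [false, true].any fun b =>
    memCode (flaggedPairs n) x (p, q, b) && memCode (List.range n) w q

/-- The power with exponent `i + 1`. -/
def relPow (n x i : ℕ) : ℕ := Nat.rec x (fun _ y => relMul n y x) i

def relOmega (n x : ℕ) : ℕ :=
  setCode (List.range n) fun p => (List.range (setCount (flaggedPairs n))).any fun i =>
    (List.range (setCount (flaggedPairs n))).any fun j => (List.range n).any fun q =>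
      [false, true].any fun b => memCode (flaggedPairs n) (relPow n x i) (p, q, b) &&
        memCode (flaggedPairs n) (relPow n x j) (q, q, true)

/-- The flag of a transition says whether its source is accepting. -/
def relLetter (c : BuchiCode ℕ) (a : ℕ) : ℕ :=
  setCode (flaggedPairs c.1) fun t => decide ((t.1, a, t.2.1) ∈ c.2.2.1) &&
    decide (t.2.2 = decide (t.1 ∈ c.2.2.2))

def relAccepting (c : BuchiCode ℕ) (w : ℕ) : Bool :=
  (List.range c.1).any fun q => memCode (List.range c.1) w q && decide (q ∈ c.2.1)

/-- The morphism into the ω-semigroup of transition relations of an automaton. -/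
def automatonHom (p : ℕ × BuchiCode ℕ) : HomCode × List Bool :=
  ((p.1, (setCount (flaggedPairs p.2.1), setCount (List.range p.2.1)),
    (List.range (setCount (flaggedPairs p.2.1))).map fun x =>
      (List.range (setCount (flaggedPairs p.2.1))).map fun y => relMul p.2.1 x y,
    (List.range (setCount (flaggedPairs p.2.1))).map fun x =>
      (List.range (setCount (List.range p.2.1))).map fun w => relMixed p.2.1 x w,
    (List.range (setCount (flaggedPairs p.2.1))).map fun x => relOmega p.2.1 x,
    (List.range p.1).map fun a => relLetter p.2 a),
    (List.range (setCount (List.range p.2.1))).map fun w => relAccepting p.2 w)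

/-! ### The algorithms are primitive recursive -/

section

variable {α : Type*} [Primcodable α]

@[fun_prop] theorem evalTable_primrec {t : α → List (List ℕ)} {f : α → List ℕ}
    {o : α → Option ℕ} {w : α → List ℕ} (ht : Primrec t) (hf : Primrec f) (ho : Primrec o)
    (hw : Primrec w) : Primrec fun a => evalTable (t a) (f a) (o a) (w a) := by
  unfold evalTable; fun_prop

@[fun_prop] theorem segmentsTable_primrec {t : α → List (List ℕ)} {f : α → List ℕ}
    {w : α → List ℕ} (ht : Primrec t) (hf : Primrec f) (hw : Primrec w) :
    Primrec fun a => segmentsTable (t a) (f a) (w a) := by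
  unfold segmentsTable; fun_prop

namespace HomCode

variable {c : α → HomCode}

@[fun_prop] theorem letterCount_primrec (hc : Primrec c) : Primrec fun a => (c a).letterCount := by
  unfold letterCount; fun_prop

@[fun_prop] theorem finCount_primrec (hc : Primrec c) : Primrec fun a => (c a).finCount := by
  unfold finCount; fun_prop

@[fun_prop] theorem infCount_primrec (hc : Primrec c) : Primrec fun a => (c a).infCount := by
  unfold infCount; fun_prop

@[fun_prop] theorem mulTable_primrec (hc : Primrec c) : Primrec fun a => (c a).mulTable := by
  unfold mulTable; fun_prop

@[fun_prop] theorem mixedTable_primrec (hc : Primrec c) : Primrec fun a => (c a).mixedTable := by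
  unfold mixedTable; fun_prop

@[fun_prop] theorem powTable_primrec (hc : Primrec c) : Primrec fun a => (c a).powTable := by
  unfold powTable; fun_prop

@[fun_prop] theorem letters_primrec (hc : Primrec c) : Primrec fun a => (c a).letters := by
  unfold letters; fun_prop

@[fun_prop] theorem assignments_primrec (hc : Primrec c) : Primrec fun a => (c a).assignments := by
  unfold assignments; fun_prop

@[fun_prop] theorem wordSignature_primrec {w : α → List ℕ} (hc : Primrec c) (hw : Primrec w) :
    Primrec fun a => (c a).wordSignature (w a) := by
  unfold wordSignature; fun_prop

@[fun_prop] theorem optElements_primrec (hc : Primrec c) : Primrec fun a => (c a).optElements := by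
  unfold optElements; fun_prop

@[fun_prop] theorem segmentLists_primrec (hc : Primrec c) :
    Primrec fun a => (c a).segmentLists := by
  unfold segmentLists; fun_prop

@[fun_prop] theorem signatureBound_primrec (hc : Primrec c) :
    Primrec fun a => (c a).signatureBound := by
  unfold signatureBound; fun_prop

@[fun_prop] theorem shortWords_primrec (hc : Primrec c) : Primrec fun a => (c a).shortWords := by
  unfold shortWords; fun_prop

@[fun_prop] theorem representatives_primrec (hc : Primrec c) :
    Primrec fun a => (c a).representatives := by
  unfold representatives; fun_prop

end HomCode

@[fun_prop] theorem buchiOf_primrec {X C : Type} [Primcodable X] [Primcodable C]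
    {states : α → List X} {letters : α → List C} {init : α → X → Bool}
    {step : α → X → C → X → Bool} {acc : α → X → Bool} (hs : Primrec states)
    (hl : Primrec letters) (hi : Primrec fun p : α × X => init p.1 p.2)
    (ht : Primrec fun p : α × X × C × X => step p.1 p.2.1 p.2.2.1 p.2.2.2)
    (ha : Primrec fun p : α × X => acc p.1 p.2) :
    Primrec fun a => buchiOf (states a) (letters a) (init a) (step a) (acc a) := by
  have ht' : Primrec fun p : ((α × X) × C) × X => step p.1.1.1 p.1.1.2 p.1.2 p.2 :=
    ht.comp (f := fun p : α × X × C × X => step p.1 p.2.1 p.2.2.1 p.2.2.2)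
      (g := fun p : ((α × X) × C) × X => (p.1.1.1, p.1.1.2, p.1.2, p.2)) (by fun_prop)
  unfold buchiOf; fun_prop

@[fun_prop] theorem phaseStep_primrec {c : α → HomCode} {T : α → List ℕ × List ℕ}
    {f w : α → List ℕ} {m m' : α → ℕ × ℕ × Option ℕ} (hc : Primrec c) (hT : Primrec T)
    (hf : Primrec f) (hw : Primrec w) (hm : Primrec m) (hm' : Primrec m') :
    Primrec fun a => phaseStep (c a) (T a) (f a) (w a) (m a) (m' a) := by
  unfold phaseStep; fun_prop

@[fun_prop] theorem evalStates_primrec {c : α → HomCode} (hc : Primrec c) :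
    Primrec fun a => evalStates (c a) := by
  unfold evalStates; fun_prop

@[fun_prop] theorem evalInit_primrec {c : α → HomCode} {x : α → EvalState} (hc : Primrec c)
    (hx : Primrec x) : Primrec fun a => evalInit (c a) (x a) := by
  unfold evalInit; fun_prop

@[fun_prop] theorem evalStep_primrec {c : α → HomCode} {T : α → List ℕ × List ℕ}
    {x y : α → EvalState} {l : α → SubstCode × ℕ} (hc : Primrec c) (hT : Primrec T)
    (hx : Primrec x) (hl : Primrec l) (hy : Primrec y) :
    Primrec fun a => evalStep (c a) (T a) (x a) (l a) (y a) := by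
  unfold evalStep; fun_prop

@[fun_prop] theorem evalAcc_primrec {x : α → EvalState} (hx : Primrec x) :
    Primrec fun a => evalAcc (x a) := by
  unfold evalAcc; fun_prop

@[fun_prop] theorem evalAutomaton_primrec {c : α → HomCode} {T : α → List ℕ × List ℕ}
    {S : α → List SubstCode} (hc : Primrec c) (hT : Primrec T) (hS : Primrec S) :
    Primrec fun a => evalAutomaton (c a) (T a) (S a) := by
  unfold evalAutomaton; fun_prop

@[fun_prop] theorem flaggedPairs_primrec {n : α → ℕ} (hn : Primrec n) :
    Primrec fun a => flaggedPairs (n a) := by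
  unfold flaggedPairs; fun_prop

@[fun_prop] theorem relMul_primrec {n x y : α → ℕ} (hn : Primrec n) (hx : Primrec x)
    (hy : Primrec y) : Primrec fun a => relMul (n a) (x a) (y a) := by
  unfold relMul; fun_prop

@[fun_prop] theorem relMixed_primrec {n x y : α → ℕ} (hn : Primrec n) (hx : Primrec x)
    (hy : Primrec y) : Primrec fun a => relMixed (n a) (x a) (y a) := by
  unfold relMixed; fun_prop

@[fun_prop] theorem relPow_primrec {n x y : α → ℕ} (hn : Primrec n) (hx : Primrec x)
    (hy : Primrec y) : Primrec fun a => relPow (n a) (x a) (y a) := by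
  unfold relPow; fun_prop

@[fun_prop] theorem relOmega_primrec {n x : α → ℕ} (hn : Primrec n) (hx : Primrec x) :
    Primrec fun a => relOmega (n a) (x a) := by
  unfold relOmega; fun_prop

@[fun_prop] theorem relLetter_primrec {c : α → BuchiCode ℕ} {x : α → ℕ} (hc : Primrec c)
    (hx : Primrec x) : Primrec fun a => relLetter (c a) (x a) := by
  unfold relLetter; fun_prop

@[fun_prop] theorem relAccepting_primrec {c : α → BuchiCode ℕ} {x : α → ℕ} (hc : Primrec c)
    (hx : Primrec x) : Primrec fun a => relAccepting (c a) (x a) := by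
  unfold relAccepting; fun_prop

end

theorem langAutomaton_primrec : Primrec langAutomaton := by
  unfold langAutomaton langTargets; fun_prop

theorem elementAutomaton_primrec : Primrec elementAutomaton := by
  unfold elementAutomaton elementTargets; fun_prop

theorem substAutomaton_primrec : Primrec substAutomaton := by
  unfold substAutomaton langTargets; fun_prop

theorem automatonHom_primrec : Primrec automatonHom := by
  unfold automatonHom; fun_prop

/-! ## Evaluation of words in ω-semigroups -/

section

variable {A F W : Type*}

/-- The value of a word under the assignment `f`, multiplied from the left by `acc`; here `none`
is a neutral element. -/
def evalFrom (mul : F → F → F) (f : A → F) (acc : Option F) (w : List A) : Option F :=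
  w.foldl (fun acc b => some (acc.elim (f b) fun x => mul x (f b))) acc

@[simp] theorem evalFrom_nil (mul : F → F → F) (f : A → F) (acc : Option F) :
    evalFrom mul f acc [] = acc := rfl

theorem evalFrom_cons (mul : F → F → F) (f : A → F) (acc : Option F) (b : A) (w : List A) :
    evalFrom mul f acc (b :: w) =
      evalFrom mul f (some (acc.elim (f b) fun x => mul x (f b))) w := rfl

theorem evalFrom_append (mul : F → F → F) (f : A → F) (acc : Option F) (v w : List A) :
    evalFrom mul f acc (v ++ w) = evalFrom mul f (evalFrom mul f acc v) w :=
  List.foldl_append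

theorem evalFrom_some_isSome (mul : F → F → F) (f : A → F) (x : F) (w : List A) :
    (evalFrom mul f (some x) w).isSome := by
  induction w generalizing x with
  | nil => rfl
  | cons b w ih => exact ih _

theorem evalFrom_isSome (mul : F → F → F) (f : A → F) (acc : Option F) {w : List A} (hw : w ≠ []) :
    (evalFrom mul f acc w).isSome := by
  cases w with
  | nil => exact absurd rfl hw
  | cons b w => exact evalFrom_some_isSome _ _ _ _

theorem evalFrom_none_eq_none_iff (mul : F → F → F) (f : A → F) {w : List A} :
    evalFrom mul f none w = none ↔ w = [] := by
  constructor
  · intro h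
    by_contra hw
    have := evalFrom_isSome mul f none hw
    simp [h] at this
  · rintro rfl; rfl

/-- The product of elements of `F` with a neutral element adjoined. -/
def optMul (mul : F → F → F) (x y : Option F) : Option F :=
  y.elim x fun y => some (x.elim y fun x => mul x y)

namespace OmegaSemigroup

variable (M : OmegaSemigroup F W)

theorem evalFrom_eq_optMul (f : A → F) (acc : Option F) (w : List A) :
    evalFrom M.mul f acc w = optMul M.mul acc (evalFrom M.mul f none w) := by
  induction w using List.reverseRecOn with
  | nil => rfl
  | append_singleton w b ih =>
    rw [evalFrom_append, evalFrom_append, ih]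
    cases evalFrom M.mul f none w with
    | none => cases acc <;> rfl
    | some y =>
      cases acc with
      | none => rfl
      | some x => simp [optMul, evalFrom_cons, M.mul_assoc]

/-- The value of a non-empty word. -/
def wordVal (f : A → F) (w : FinWord A) : F :=
  (evalFrom M.mul f none w.1).get (evalFrom_isSome _ _ _ w.2)

theorem some_wordVal (f : A → F) (w : FinWord A) :
    some (M.wordVal f w) = evalFrom M.mul f none w.1 := Option.some_get _

theorem wordVal_append (f : A → F) (u v : FinWord A) :
    M.wordVal f (u.append v) = M.mul (M.wordVal f u) (M.wordVal f v) := by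
  apply Option.some.inj
  rw [some_wordVal, FinWord.append, evalFrom_append, evalFrom_eq_optMul, ← some_wordVal,
    ← some_wordVal]
  rfl

theorem wordVal_singleton (f : A → F) (a : A) : M.wordVal f ⟨[a], List.cons_ne_nil a []⟩ = f a :=
  rfl

theorem prod_prepend (f : A → F) (v : FinWord A) (α : ℕ → A) :
    M.prod (fun n => f (v.prepend α n)) = M.mixed (M.wordVal f v) (M.prod fun n => f (α n)) := by
  obtain ⟨v, hv⟩ := v
  induction v with
  | nil => exact absurd rfl hv
  | cons a v ih =>
    have hs : ∀ β : ℕ → A, M.prod (fun n => f (FinWord.prepend ⟨[a], List.cons_ne_nil a []⟩ β n)) =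
        M.mixed (f a) (M.prod fun n => f (β n)) := by
      intro β
      rw [M.mixed_prod]
      congr 1
      funext n
      cases n <;> simp [FinWord.prepend]
    rcases eq_or_ne v [] with rfl | hv'
    · exact hs α
    · have : (⟨a :: v, hv⟩ : FinWord A) =
          FinWord.append ⟨[a], List.cons_ne_nil a []⟩ ⟨v, hv'⟩ := rfl
      rw [this, FinWord.prepend_append, hs, ih hv', wordVal_append, M.mixed_assoc,
        wordVal_singleton]

theorem some_segProd (f : A → F) (α : ℕ → A) (i l : ℕ) :
    some (segProd M.mul (fun n => f (α n)) i l) =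
      evalFrom M.mul f none ((List.range' i (l + 1)).map α) := by
  induction l with
  | zero => rfl
  | succ l ih =>
    rw [List.range'_concat, List.map_append, evalFrom_append, ← ih, segProd, one_mul, ← add_assoc]
    rfl

theorem map_range'_infConcat (u : ℕ → FinWord A) (n : ℕ) :
    (List.range' (FinWord.flat u n).length (u n).1.length).map (FinWord.infConcat u) = (u n).1 := by
  refine List.ext_getElem? fun i => ?_
  by_cases hi : i < (u n).1.length
  · rw [List.getElem?_map, List.getElem?_range' hi, one_mul, Option.map_some]
    have hlt : (FinWord.flat u n).length + i < (FinWord.flat u (n + 1)).length := by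
      simp only [FinWord.flat, List.length_append]; omega
    rw [← FinWord.flat_getElem? u hlt, FinWord.flat, List.getElem?_append_right (by omega)]
    congr 1; omega
  · rw [List.getElem?_eq_none (by simpa using hi), List.getElem?_eq_none (by simpa using hi)]

theorem prod_infConcat (f : A → F) (u : ℕ → FinWord A) :
    M.prod (fun n => f (FinWord.infConcat u n)) = M.prod fun n => M.wordVal f (u n) := by
  have hpos : ∀ n, 0 < (u n).1.length := fun n => List.length_pos_of_ne_nil (u n).2
  have hlen : ∀ n, (FinWord.flat u (n + 1)).length =
      (FinWord.flat u n).length + (u n).1.length := fun n => by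
    simp only [FinWord.flat, List.length_append]
  have hk : StrictMono fun n => (FinWord.flat u (n + 1)).length - 1 := by
    refine strictMono_nat_of_lt_succ fun n => ?_
    have h1 := hpos (n + 1)
    have h2 := hpos n
    have h3 := hlen (n + 1)
    have h4 := hlen n
    omega
  rw [M.prod_blocks _ _ hk]
  congr 1
  funext n
  have key : ∀ n, M.wordVal f (u n) =
      segProd M.mul (fun n => f (FinWord.infConcat u n)) (FinWord.flat u n).length
        ((u n).1.length - 1) := by
    intro n
    apply Option.some.inj
    rw [some_segProd, some_wordVal, Nat.sub_add_cancel (hpos n), map_range'_infConcat]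
  rw [key]
  cases n with
  | zero => simp [blockProd, FinWord.flat]
  | succ n =>
    have h1 := hpos n
    have h2 := hpos (n + 1)
    have h3 := hlen n
    have h4 := hlen (n + 1)
    rw [blockProd]
    congr 1 <;> omega

end OmegaSemigroup

/-- The morphism that maps the letters according to `f`. -/
def WordHom.ofLetters (M : OmegaSemigroup F W) (f : A → F) : WordHom A M where
  fin := M.wordVal f
  inf α := M.prod fun n => f (α n)
  map_mul := M.wordVal_append f
  map_mixed := M.prod_prepend f
  map_prod := M.prod_infConcat f

/-- The image of a letter. -/
def OmegaHom.letter {M : OmegaSemigroup F W} (h : WordHom A M) (a : A) : F :=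
  h.fin ⟨[a], List.cons_ne_nil a []⟩

theorem WordHom.letter_ofLetters (M : OmegaSemigroup F W) (f : A → F) :
    (WordHom.ofLetters M f).letter = f := rfl

theorem OmegaHom.some_fin {M : OmegaSemigroup F W} (h : WordHom A M) (w : FinWord A) :
    some (h.fin w) = evalFrom M.mul h.letter none w.1 := by
  obtain ⟨w, hw⟩ := w
  induction w using List.reverseRecOn with
  | nil => exact absurd rfl hw
  | append_singleton w b ih =>
    rcases eq_or_ne w [] with rfl | hw'
    · rfl
    · have : (⟨w ++ [b], hw⟩ : FinWord A) =
          FinWord.append ⟨w, hw'⟩ ⟨[b], List.cons_ne_nil b []⟩ := rfl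
      rw [this, FinWord.append, evalFrom_append, ← ih hw']
      exact congrArg some (h.map_mul _ _)

theorem WordHom.eval_eq {M : OmegaSemigroup F W} (h : WordHom A M) (w : List A) :
    (WordHom.eval h w : Option F) = evalFrom M.mul h.letter none w := by
  cases w with
  | nil => rfl
  | cons a w => exact h.some_fin ⟨a :: w, List.cons_ne_nil a w⟩

end

/-! ## The ω-semigroup of transition relations -/

theorem List.ofFn_fin_val {β : Type*} (n : ℕ) (f : ℕ → β) :
    List.ofFn (fun i : Fin n => f i) = (List.range n).map f := by
  refine List.ext_getElem (by simp) fun i h1 h2 => by simp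

theorem exists_lt_eq_of_step {N : ℕ} {a : ℕ → ℕ} (hN : ∀ i, a i < N)
    (hs : ∀ i j, a i = a j → a (i + 1) = a (j + 1)) (i : ℕ) : ∃ j < N, a i = a j := by
  induction i using Nat.strong_induction_on with
  | _ i ih =>
    by_cases hi : i < N
    · exact ⟨i, hi, rfl⟩
    · obtain ⟨s, hs1, t, ht1, hne, heq⟩ := Finset.exists_ne_map_eq_of_card_lt_of_maps_to
        (s := Finset.range (N + 1)) (t := Finset.range N) (f := a) (by simp)
        (fun j _ => by simpa using hN j)
      wlog hst : s < t generalizing s t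
      · exact this t ht1 s hs1 hne.symm heq.symm (by omega)
      have hd : ∀ d, a (s + d) = a (t + d) := by
        intro d
        induction d with
        | zero => exact heq
        | succ d ihd => exact hs _ _ ihd
      simp only [Finset.mem_range] at hs1 ht1
      have h1 := hd (i - t)
      rw [Nat.add_sub_cancel' (by omega)] at h1
      obtain ⟨j, hj, hj'⟩ := ih (s + (i - t)) (by omega)
      exact ⟨j, hj, h1.symm.trans hj'⟩

theorem mem_flaggedPairs {n p q : ℕ} {b : Bool} : (p, q, b) ∈ flaggedPairs n ↔ p < n ∧ q < n := by
  cases b <;> simp [flaggedPairs]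

theorem flaggedPairs_nodup (n : ℕ) : (flaggedPairs n).Nodup := by
  rw [flaggedPairs, List.nodup_flatMap]
  refine ⟨fun p _ => ?_, (List.nodup_range).imp fun {p p'} hne => ?_⟩
  · rw [List.nodup_flatMap]
    refine ⟨fun q _ => by simp, (List.nodup_range).imp fun {q q'} hne => ?_⟩
    simp only [Function.onFun, List.disjoint_left, List.mem_map]
    rintro _ ⟨b, _, rfl⟩ ⟨b', _, h⟩
    exact hne (congrArg (fun t => t.2.1) h).symm
  · simp only [Function.onFun, List.disjoint_left, List.mem_flatMap, List.mem_map]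
    rintro _ ⟨_, _, b, _, rfl⟩ ⟨_, _, b', _, h⟩
    exact hne (congrArg (fun t => t.1) h).symm

/-- The coded relation `x` has an edge from `p` to `q` with flag `b`. -/
def RelEdge (n x p q : ℕ) (b : Bool) : Prop := memCode (flaggedPairs n) x (p, q, b) = true

theorem RelEdge.lt {n x p q : ℕ} {b : Bool} (h : RelEdge n x p q b) : p < n ∧ q < n :=
  mem_flaggedPairs.1 (mem_of_memCode h)

theorem relEdge_mul {n x y p q : ℕ} {b : Bool} : RelEdge n (relMul n x y) p q b ↔
    ∃ r b₁ b₂, RelEdge n x p r b₁ ∧ RelEdge n y r q b₂ ∧ b = (b₁ || b₂) := by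
  have hB : ∀ b : Bool, b ∈ [false, true] := by decide
  rw [RelEdge, relMul, memCode_setCode_iff, mem_flaggedPairs]
  simp only [List.any_eq_true, List.mem_range, Bool.and_eq_true, decide_eq_true_eq, hB, true_and]
  constructor
  · rintro ⟨_, r, _, b₁, b₂, ⟨h1, h2⟩, h3⟩
    exact ⟨r, b₁, b₂, h1, h2, h3⟩
  · rintro ⟨r, b₁, b₂, h1, h2, h3⟩
    exact ⟨⟨h1.lt.1, h2.lt.2⟩, r, h1.lt.2, b₁, b₂, ⟨h1, h2⟩, h3⟩

theorem mem_relMixed {n x w p : ℕ} : memCode (List.range n) (relMixed n x w) p = true ↔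
    ∃ q b, RelEdge n x p q b ∧ memCode (List.range n) w q = true := by
  have hB : ∀ b : Bool, b ∈ [false, true] := by decide
  rw [relMixed, memCode_setCode_iff]
  simp only [List.any_eq_true, List.mem_range, Bool.and_eq_true, hB, true_and]
  constructor
  · rintro ⟨_, q, _, b, h1, h2⟩
    exact ⟨q, b, h1, h2⟩
  · rintro ⟨q, b, h1, h2⟩
    exact ⟨RelEdge.lt h1 |>.1, q, RelEdge.lt h1 |>.2, b, h1, h2⟩

/-- There is an infinite path from `p` through the relations `m 0, m 1, …` with infinitely many
flags. -/
def RelProd (n : ℕ) (m : ℕ → ℕ) (p : ℕ) : Prop :=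
  ∃ (q : ℕ → ℕ) (b : ℕ → Bool), q 0 = p ∧ (∀ i, RelEdge n (m i) (q i) (q (i + 1)) (b i)) ∧
    ∀ N, ∃ i ≥ N, b i = true

theorem RelProd.lt {n : ℕ} {m : ℕ → ℕ} {p : ℕ} (h : RelProd n m p) : p < n := by
  obtain ⟨q, b, rfl, hq, -⟩ := h
  exact (hq 0).lt.1

theorem relProd_casesOn {n a : ℕ} {m : ℕ → ℕ} {p : ℕ} :
    RelProd n (fun i => Nat.casesOn i a m) p ↔ ∃ q b, RelEdge n a p q b ∧ RelProd n m q := by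
  constructor
  · rintro ⟨q, b, rfl, hq, hb⟩
    refine ⟨q 1, b 0, hq 0, fun i => q (i + 1), fun i => b (i + 1), rfl, fun i => hq (i + 1),
      fun N => ?_⟩
    obtain ⟨i, hi, hbi⟩ := hb (N + 1)
    obtain ⟨i, rfl⟩ : ∃ j, i = j + 1 := ⟨i - 1, by omega⟩
    exact ⟨i, by omega, hbi⟩
  · rintro ⟨q₁, b₁, h, q, b, rfl, hq, hb⟩
    refine ⟨fun i => Nat.casesOn i p q, fun i => Nat.casesOn i b₁ b, rfl, fun i => ?_, fun N => ?_⟩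
    · cases i with
      | zero => exact h
      | succ i => exact hq i
    · obtain ⟨i, hi, hbi⟩ := hb N
      exact ⟨i + 1, by omega, hbi⟩

theorem relEdge_segProd {n : ℕ} {m q : ℕ → ℕ} {b : ℕ → Bool} {i l : ℕ}
    (h : ∀ j, i ≤ j → j ≤ i + l → RelEdge n (m j) (q j) (q (j + 1)) (b j)) :
    ∃ b', RelEdge n (segProd (relMul n) m i l) (q i) (q (i + l + 1)) b' ∧
      (b' = true ↔ ∃ j, i ≤ j ∧ j ≤ i + l ∧ b j = true) := by
  induction l with
  | zero =>
    refine ⟨b i, h i le_rfl le_rfl, fun hb => ⟨i, le_rfl, le_rfl, hb⟩, ?_⟩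
    rintro ⟨j, h1, h2, h3⟩
    obtain rfl : j = i := by omega
    exact h3
  | succ l ih =>
    obtain ⟨b', h1, h2⟩ := ih fun j hj hj' => h j hj (by omega)
    refine ⟨b' || b (i + l + 1), relEdge_mul.2 ⟨_, _, _, h1, h (i + l + 1) (by omega) le_rfl, rfl⟩,
      ?_⟩
    rw [Bool.or_eq_true, h2]
    constructor
    · rintro (⟨j, h3, h4, h5⟩ | h3)
      · exact ⟨j, h3, by omega, h5⟩
      · exact ⟨_, by omega, le_rfl, h3⟩
    · rintro ⟨j, h3, h4, h5⟩
      rcases Nat.lt_or_ge j (i + l + 1) with hj | hj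
      · exact Or.inl ⟨j, h3, by omega, h5⟩
      · obtain rfl : j = i + l + 1 := by omega
        exact Or.inr h5

theorem RelEdge.exists_path {n : ℕ} {m : ℕ → ℕ} {i l p r : ℕ} {b' : Bool}
    (h : RelEdge n (segProd (relMul n) m i l) p r b') : ∃ (q : ℕ → ℕ) (b : ℕ → Bool), q i = p ∧
      q (i + l + 1) = r ∧ (∀ j, i ≤ j → j ≤ i + l → RelEdge n (m j) (q j) (q (j + 1)) (b j)) ∧
      (b' = true ↔ ∃ j, i ≤ j ∧ j ≤ i + l ∧ b j = true) := by
  induction l generalizing r b' with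
  | zero =>
    refine ⟨fun j => if j = i then p else r, fun _ => b', by simp, by simp, fun j h1 h2 => ?_,
      fun hb => ⟨i, le_rfl, le_rfl, hb⟩, fun ⟨_, _, _, hb⟩ => hb⟩
    obtain rfl : j = i := by omega
    simpa [segProd] using h
  | succ l ih =>
    obtain ⟨s, b₁, b₂, h1, h2, rfl⟩ := relEdge_mul.1 h
    obtain ⟨q, b, hq1, hq2, hq3, hq4⟩ := ih h1
    refine ⟨fun j => if j ≤ i + l + 1 then q j else r, fun j => if j ≤ i + l then b j else b₂,
      by simp [hq1, add_assoc], by simp [add_assoc], fun j hj hj' => ?_, ?_⟩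
    · by_cases hjl : j ≤ i + l
      · simpa [hjl, show j ≤ i + l + 1 by omega] using hq3 j hj hjl
      · obtain rfl : j = i + l + 1 := by omega
        simpa [hq2] using h2
    · rw [Bool.or_eq_true, hq4]
      constructor
      · rintro (⟨j, h3, h4, h5⟩ | h3)
        · exact ⟨j, h3, by omega, by simpa [h4] using h5⟩
        · exact ⟨i + l + 1, by omega, le_rfl, by simpa using h3⟩
      · rintro ⟨j, h3, h4, h5⟩
        by_cases hjl : j ≤ i + l
        · exact Or.inl ⟨j, h3, hjl, by simpa [hjl] using h5⟩
        · exact Or.inr (by simpa [hjl] using h5)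

theorem blockProd_eq {F : Type*} (mul : F → F → F) (m : ℕ → F) {k : ℕ → ℕ} (hk : StrictMono k)
    (i : ℕ) : ∃ l, blockProd mul m k i = segProd mul m (Nat.casesOn i 0 fun j => k j + 1) l ∧
      (Nat.casesOn i 0 fun j => k j + 1 : ℕ) + l = k i := by
  cases i with
  | zero => exact ⟨k 0, rfl, by simp⟩
  | succ i =>
    have := hk (Nat.lt_succ_self i)
    exact ⟨_, rfl, by simp only [Nat.succ_eq_add_one] at this ⊢; omega⟩

theorem relProd_blocks {n : ℕ} {m k : ℕ → ℕ} (hk : StrictMono k) {p : ℕ} :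
    RelProd n m p ↔ RelProd n (blockProd (relMul n) m k) p := by
  set s : ℕ → ℕ := fun i => Nat.casesOn i 0 fun j => k j + 1 with hs
  have hs0 : s 0 = 0 := rfl
  have hs1 : ∀ i, s (i + 1) = k i + 1 := fun i => rfl
  choose l hl1 hl2 using blockProd_eq (relMul n) m hk
  change ∀ i, s i + l i = k i at hl2
  constructor
  · rintro ⟨q, b, rfl, hq, hb⟩
    choose b' hb1 hb2 using fun i => relEdge_segProd (n := n) (m := m) (q := q) (b := b)
      (i := s i) (l := l i) fun j _ _ => hq j
    refine ⟨fun i => q (s i), b', rfl, fun i => ?_, fun N => ?_⟩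
    · have := hb1 i
      rw [hl2 i] at this
      rw [hl1]
      exact this
    · obtain ⟨j, hj, hbj⟩ := hb (s N)
      have hex : ∃ i, j ≤ k i := ⟨j, hk.le_apply⟩
      refine ⟨Nat.find hex, ?_, (hb2 _).2 ⟨j, ?_, ?_, hbj⟩⟩
      · by_contra hc
        have h1 := Nat.find_spec hex
        obtain ⟨N', rfl⟩ : ∃ N', N = N' + 1 := ⟨N - 1, by omega⟩
        have h2 := hk.monotone (show Nat.find hex ≤ N' by omega)
        rw [hs1] at hj
        omega
      · rcases hf : Nat.find hex with _ | i
        · rw [hs0]; omega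
        · rw [hs1]
          have := Nat.find_min hex (m := i) (by omega)
          omega
      · rw [hl2]; exact Nat.find_spec hex
  · rintro ⟨q, b, rfl, hq, hb⟩
    have hq' : ∀ i, RelEdge n (segProd (relMul n) m (s i) (l i)) (q i) (q (i + 1)) (b i) :=
      fun i => by have := hq i; rwa [hl1] at this
    choose Q B hQ1 hQ2 hQ3 hQ4 using fun i => (hq' i).exists_path
    have hex : ∀ j, ∃ i, j ≤ k i := fun j => ⟨j, hk.le_apply⟩
    have huniq : ∀ i j, s i ≤ j → j ≤ k i → Nat.find (hex j) = i := by
      intro i j h1 h2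
      refine (Nat.find_eq_iff _).2 ⟨h2, fun i' hi' => ?_⟩
      obtain ⟨i, rfl⟩ : ∃ i₀, i = i₀ + 1 := ⟨i - 1, by omega⟩
      rw [hs1] at h1
      have := hk.monotone (show i' ≤ i by omega)
      omega
    have hstart : ∀ j, s (Nat.find (hex j)) ≤ j := by
      intro j
      rcases hf : Nat.find (hex j) with _ | i
      · rw [hs0]; omega
      · rw [hs1]
        have := Nat.find_min (hex j) (m := i) (by omega)
        omega
    refine ⟨fun j => Q (Nat.find (hex j)) j, fun j => B (Nat.find (hex j)) j, ?_, fun j => ?_,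
      fun N => ?_⟩
    · change Q (Nat.find (hex 0)) 0 = q 0
      rw [huniq 0 0 hs0.le (Nat.zero_le _)]
      exact hQ1 0
    · have h1 := Nat.find_spec (hex j)
      have h2 := hstart j
      have h3 := hQ3 (Nat.find (hex j)) j h2 (by rw [hl2]; exact h1)
      change RelEdge n (m j) (Q (Nat.find (hex j)) j) (Q (Nat.find (hex (j + 1))) (j + 1))
        (B (Nat.find (hex j)) j)
      generalize Nat.find (hex j) = i at h1 h2 h3 ⊢
      rcases Nat.lt_or_ge j (k i) with hlt | hge
      · rw [huniq i (j + 1) (by omega) (by omega)]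
        exact h3
      · obtain rfl : j = k i := by omega
        have := hk (Nat.lt_succ_self i)
        rw [huniq (i + 1) (k i + 1) (by rw [hs1]) this]
        have h4 := hQ1 (i + 1)
        have h5 := hQ2 i
        rw [hs1] at h4
        rw [hl2] at h5
        rw [h4, ← h5]
        exact h3
    · obtain ⟨i, hi, hbi⟩ := hb N
      obtain ⟨j, h1, h2, h3⟩ := (hQ4 i).1 hbi
      rw [hl2] at h2
      refine ⟨j, ?_, ?_⟩
      · have : i ≤ s i := by
          cases i with
          | zero => omega
          | succ i => rw [hs1]; have : i ≤ k i := hk.le_apply; omega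
        omega
      · change B (Nat.find (hex j)) j = true
        rw [huniq i j h1 h2]; exact h3

theorem segProd_const (n x i l : ℕ) : segProd (relMul n) (fun _ => x) i l = relPow n x l := by
  induction l with
  | zero => rfl
  | succ l ih => rw [segProd, ih]; rfl

theorem relPow_exponent {n x : ℕ} (hx : x < setCount (flaggedPairs n)) (i : ℕ) :
    ∃ j < setCount (flaggedPairs n), relPow n x i = relPow n x j := by
  refine exists_lt_eq_of_step (fun i => ?_) (fun i j h => ?_) i
  · cases i with
    | zero => exact hx
    | succ i => exact setCode_lt _ _
  · exact congrArg (fun y => relMul n y x) h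

theorem exists_infinite_value {n : ℕ} {q : ℕ → ℕ} (hq : ∀ i, q i < n) :
    ∃ v, ∀ N, ∃ i ≥ N, q i = v := by
  obtain ⟨v, hv⟩ := Finite.exists_infinite_fiber fun i => (⟨q i, hq i⟩ : Fin n)
  rw [Set.infinite_coe_iff] at hv
  refine ⟨v, fun N => ?_⟩
  obtain ⟨i, hi, hN⟩ := hv.exists_gt N
  exact ⟨i, hN.le, congrArg Fin.val (show (⟨q i, hq i⟩ : Fin n) = v from hi)⟩

theorem mem_relOmega {n x p : ℕ} (hx : x < setCount (flaggedPairs n)) :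
    memCode (List.range n) (relOmega n x) p = true ↔ RelProd n (fun _ => x) p := by
  have hB : ∀ b : Bool, b ∈ [false, true] := by decide
  rw [relOmega, memCode_setCode_iff]
  simp only [List.any_eq_true, List.mem_range, Bool.and_eq_true, hB, true_and]
  constructor
  · rintro ⟨_, i, _, j, _, q, _, b, h1, h2⟩
    have hk : StrictMono fun t => i + t * (j + 1) :=
      strictMono_nat_of_lt_succ fun t => by rw [Nat.succ_mul]; omega
    rw [relProd_blocks hk]
    refine ⟨fun t => Nat.casesOn t p fun _ => q, fun t => Nat.casesOn t b fun _ => true, rfl,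
      fun t => ?_, fun N => ⟨N + 1, by omega, rfl⟩⟩
    cases t with
    | zero =>
      rw [blockProd, segProd_const, zero_mul, add_zero]
      exact h1
    | succ t =>
      rw [blockProd, segProd_const]
      have : i + (t + 1) * (j + 1) - (i + t * (j + 1) + 1) = j := by rw [Nat.succ_mul]; omega
      rw [this]
      exact h2
  · intro h
    refine ⟨h.lt, ?_⟩
    obtain ⟨q, b, rfl, hq, hb⟩ := h
    obtain ⟨v, hv⟩ := exists_infinite_value fun i => (hq i).lt.1
    obtain ⟨i, hi, hiv⟩ := hv 1
    obtain ⟨N, hN, hbN⟩ := hb i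
    obtain ⟨j, hj, hjv⟩ := hv (N + 1)
    obtain ⟨b₁, h1, -⟩ := relEdge_segProd (n := n) (m := fun _ => x) (q := q) (b := b) (i := 0)
      (l := i - 1) fun j _ _ => hq j
    obtain ⟨b₂, h2, h3⟩ := relEdge_segProd (n := n) (m := fun _ => x) (q := q) (b := b) (i := i)
      (l := j - i - 1) fun j _ _ => hq j
    rw [segProd_const] at h1 h2
    rw [show 0 + (i - 1) + 1 = i by omega, hiv] at h1
    rw [show i + (j - i - 1) + 1 = j by omega, hiv, hjv] at h2
    obtain rfl : b₂ = true := h3.2 ⟨N, hN, by omega, hbN⟩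
    obtain ⟨i', hi', he⟩ := relPow_exponent hx (i - 1)
    obtain ⟨j', hj', he'⟩ := relPow_exponent hx (j - i - 1)
    rw [he] at h1
    rw [he'] at h2
    exact ⟨i', hi', j', hj', v, h1.lt.2, b₁, h1, h2⟩

open Classical in
/-- The set of states with an infinite path through the given relations that has infinitely many
flags. -/
noncomputable def relProdCode (n : ℕ) (m : ℕ → ℕ) : ℕ :=
  setCode (List.range n) fun p => decide (RelProd n m p)

open Classical in
theorem mem_relProdCode {n : ℕ} {m : ℕ → ℕ} {p : ℕ} :
    memCode (List.range n) (relProdCode n m) p = true ↔ RelProd n m p := by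
  rw [relProdCode, memCode_setCode_iff, decide_eq_true_eq, List.mem_range]
  exact ⟨fun h => h.2, fun h => ⟨h.lt, h⟩⟩

theorem relProdCode_congr {n : ℕ} {m m' : ℕ → ℕ} (h : ∀ p, RelProd n m p ↔ RelProd n m' p) :
    relProdCode n m = relProdCode n m' :=
  memCode_ext List.nodup_range (setCode_lt _ _) (setCode_lt _ _) fun p => by
    rw [mem_relProdCode, mem_relProdCode, h]

theorem coe_segProd {N : ℕ} {mul : Fin N → Fin N → Fin N} {mul' : ℕ → ℕ → ℕ}
    (h : ∀ x y, (mul x y : ℕ) = mul' x y) (m : ℕ → Fin N) (i l : ℕ) :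
    (segProd mul m i l).val = segProd mul' (fun j => m j) i l := by
  induction l with
  | zero => rfl
  | succ l ih => rw [segProd, h, ih]; rfl

theorem coe_blockProd {N : ℕ} {mul : Fin N → Fin N → Fin N} {mul' : ℕ → ℕ → ℕ}
    (h : ∀ x y, (mul x y : ℕ) = mul' x y) (m : ℕ → Fin N) (k : ℕ → ℕ) (i : ℕ) :
    (blockProd mul m k i).val = blockProd mul' (fun j => m j) k i := by
  cases i <;> exact coe_segProd h _ _ _

/-- The ω-semigroup of flagged relations on `n` states and of sets of states. -/
noncomputable def relOmegaSemigroup (n : ℕ) :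
    OmegaSemigroup (Fin (setCount (flaggedPairs n))) (Fin (setCount (List.range n))) where
  mul x y := ⟨relMul n x y, setCode_lt _ _⟩
  mixed x w := ⟨relMixed n x w, setCode_lt _ _⟩
  prod m := ⟨relProdCode n fun i => m i, setCode_lt _ _⟩
  mul_assoc x y z := by
    refine Fin.ext (memCode_ext (flaggedPairs_nodup n) (setCode_lt _ _) (setCode_lt _ _) ?_)
    rintro ⟨p, q, b⟩
    change RelEdge n (relMul n (relMul n x y) z) p q b ↔ RelEdge n (relMul n x (relMul n y z)) p q b
    rw [relEdge_mul, relEdge_mul]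
    constructor
    · rintro ⟨r, b₁, b₂, h1, h2, rfl⟩
      obtain ⟨s, b₃, b₄, h3, h4, rfl⟩ := relEdge_mul.1 h1
      exact ⟨s, b₃, _, h3, relEdge_mul.2 ⟨r, b₄, b₂, h4, h2, rfl⟩, Bool.or_assoc _ _ _⟩
    · rintro ⟨r, b₁, b₂, h1, h2, rfl⟩
      obtain ⟨s, b₃, b₄, h3, h4, rfl⟩ := relEdge_mul.1 h2
      exact ⟨s, _, b₄, relEdge_mul.2 ⟨r, b₁, b₃, h1, h3, rfl⟩, h4, (Bool.or_assoc _ _ _).symm⟩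
  mixed_assoc x y w := by
    refine Fin.ext (memCode_ext List.nodup_range (setCode_lt _ _) (setCode_lt _ _) fun p => ?_)
    rw [mem_relMixed, mem_relMixed]
    constructor
    · rintro ⟨q, b, h1, h2⟩
      obtain ⟨r, b₁, b₂, h3, h4, -⟩ := relEdge_mul.1 h1
      exact ⟨r, b₁, h3, mem_relMixed.2 ⟨q, b₂, h4, h2⟩⟩
    · rintro ⟨r, b₁, h1, h2⟩
      obtain ⟨q, b₂, h3, h4⟩ := mem_relMixed.1 h2
      exact ⟨q, _, relEdge_mul.2 ⟨r, b₁, b₂, h1, h3, rfl⟩, h4⟩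
  prod_blocks m k hk := by
    refine Fin.ext (relProdCode_congr fun p => ?_)
    rw [relProd_blocks hk]
    refine iff_of_eq (congrArg (fun m => RelProd n m p) ?_)
    funext i
    exact (coe_blockProd (fun _ _ => rfl) m k i).symm
  mixed_prod a m := by
    refine Fin.ext (memCode_ext List.nodup_range (setCode_lt _ _) (setCode_lt _ _) fun p => ?_)
    have he : (fun i => ((Nat.casesOn i a m : Fin (setCount (flaggedPairs n))) : ℕ)) =
        fun i => Nat.casesOn i (a : ℕ) fun j => (m j : ℕ) := by
      funext i; cases i <;> rfl
    rw [mem_relMixed, mem_relProdCode, he, relProd_casesOn]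
    simp only [mem_relProdCode]

/-- The morphism given by the transitions of an automaton. -/
noncomputable def relHom (k : ℕ) (c : BuchiCode ℕ) : WordHom (Fin k) (relOmegaSemigroup c.1) :=
  WordHom.ofLetters _ fun a => ⟨relLetter c a, setCode_lt _ _⟩

theorem relEdge_letter {c : BuchiCode ℕ} {a p q : ℕ} {b : Bool} : RelEdge c.1 (relLetter c a) p q b ↔
    (p < c.1 ∧ q < c.1) ∧ (p, a, q) ∈ c.2.2.1 ∧ b = decide (p ∈ c.2.2.2) := by
  rw [RelEdge, relLetter, memCode_setCode_iff, mem_flaggedPairs, Bool.and_eq_true,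
    decide_eq_true_eq, decide_eq_true_eq]

theorem automatonHom_spec (k : ℕ) (c : BuchiCode ℕ) :
    ∃ (nf nw : ℕ) (M : OmegaSemigroup (Fin nf) (Fin nw)) (h : WordHom (Fin k) M)
      (H : Finset (Fin nw)), automatonHom (k, c) = (h.code, finsetCode H) ∧
        Recognises h (H : Set (Fin nw))
          {α : ℕ → Fin k | (c.automaton (fun a : Fin k => (a : ℕ))).Accepts α} := by
  refine ⟨_, _, relOmegaSemigroup c.1, relHom k c,
    Finset.univ.filter fun w => relAccepting c w = true, ?_, fun α => ?_⟩
  · rw [automatonHom, OmegaHom.code, finsetCode]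
    refine Prod.ext (Prod.ext rfl (Prod.ext rfl (Prod.ext ?_ (Prod.ext ?_ (Prod.ext ?_ ?_))))) ?_
    · simp only [← List.ofFn_fin_val]; rfl
    · simp only [← List.ofFn_fin_val]; rfl
    · simp only [← List.ofFn_fin_val]
      congr 1
      funext x
      refine memCode_ext List.nodup_range (setCode_lt _ _) (setCode_lt _ _) fun p => ?_
      rw [mem_relOmega x.2]
      exact mem_relProdCode.symm
    · simp only [← List.ofFn_fin_val]; rfl
    · simp [← List.ofFn_fin_val]
  · have hinf : ∀ p, memCode (List.range c.1) ((relHom k c).inf α) p = true ↔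
        RelProd c.1 (fun i => relLetter c (α i)) p := fun p => mem_relProdCode
    simp only [Finset.coe_filter, Finset.mem_univ, true_and, Set.mem_ofPred_eq, relAccepting,
      List.any_eq_true, Bool.and_eq_true, decide_eq_true_eq, hinf]
    constructor
    · rintro ⟨r, h1, h2, h3⟩
      refine ⟨r 0, List.mem_range.2 (r 0).2, ⟨fun i => r i, fun i => decide ((r i : ℕ) ∈ c.2.2.2),
        rfl, fun i => relEdge_letter.2 ⟨⟨(r i).2, (r (i + 1)).2⟩, h2 i, rfl⟩, fun N => ?_⟩, h1⟩
      obtain ⟨i, hi, hr⟩ := h3 N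
      exact ⟨i, hi, decide_eq_true hr⟩
    · rintro ⟨p, -, ⟨q, b, rfl, hq, hb⟩, hp⟩
      have hq' := fun i => relEdge_letter.1 (hq i)
      refine ⟨fun i => ⟨q i, (hq' i).1.1⟩, hp, fun i => (hq' i).2.1, fun N => ?_⟩
      obtain ⟨i, hi, hbi⟩ := hb N
      rw [(hq' i).2.2, decide_eq_true_eq] at hbi
      exact ⟨i, hi, hbi⟩

/-! ## First occurrences and segments -/

theorem evalFrom_flatMap_congr {A F W : Type*} (M : OmegaSemigroup F W) (f : A → F)
    {l l' : List (A × List A)}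
    (h : l.map (fun p => (p.1, evalFrom M.mul f none p.2)) =
      l'.map (fun p => (p.1, evalFrom M.mul f none p.2))) (acc : Option F) :
    evalFrom M.mul f acc (l.flatMap fun p => p.1 :: p.2) =
      evalFrom M.mul f acc (l'.flatMap fun p => p.1 :: p.2) := by
  induction l generalizing l' acc with
  | nil => cases l' with
    | nil => rfl
    | cons p l' => simp at h
  | cons p l ih => cases l' with
    | nil => simp at h
    | cons p' l' =>
      simp only [List.map_cons, List.cons.injEq, Prod.mk.injEq] at h
      obtain ⟨⟨h1, h2⟩, h3⟩ := h
      rw [List.flatMap_cons, List.flatMap_cons, evalFrom_append, evalFrom_append, evalFrom_cons,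
        evalFrom_cons, h1, M.evalFrom_eq_optMul f _ p.2, M.evalFrom_eq_optMul f _ p'.2, h2]
      exact ih h3 _

section

variable {A : Type*} [DecidableEq A]

theorem splitSeen_flatMap (seen : Finset A) (w : List A) :
    (splitSeen seen w).1 ++ (splitSeen seen w).2.flatMap (fun p => p.1 :: p.2) = w := by
  induction w generalizing seen with
  | nil => rfl
  | cons b w ih =>
    rw [splitSeen]
    split_ifs with hb
    · rw [List.cons_append, ih]
    · simpa using ih _

theorem splitSeen_nodup (seen : Finset A) (w : List A) :
    ((splitSeen seen w).2.map Prod.fst).Nodup ∧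
      ∀ b ∈ (splitSeen seen w).2.map Prod.fst, b ∉ seen := by
  induction w generalizing seen with
  | nil => simp [splitSeen]
  | cons b w ih =>
    rw [splitSeen]
    split_ifs with hb
    · exact ih seen
    · obtain ⟨h1, h2⟩ := ih (insert b seen)
      rw [List.map_cons, List.nodup_cons]
      refine ⟨⟨fun h => h2 b h (Finset.mem_insert_self _ _), h1⟩, fun a ha => ?_⟩
      rcases List.mem_cons.1 ha with rfl | ha
      · exact hb
      · exact fun h => h2 a ha (Finset.mem_insert_of_mem h)

theorem firstOccurrences_cons (b : A) (w : List A) : firstOccurrences (b :: w) =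
    (b, (splitSeen {b} w).1) :: (splitSeen {b} w).2 := by
  rw [firstOccurrences, splitSeen, if_neg (Finset.notMem_empty b)]
  rfl

/-- The segments of a word determine its first letter and the value of the remaining word. -/
theorem head_tail_of_segments {F W : Type*} (M : OmegaSemigroup F W) (f : A → F)
    {v w : List A} (h : (firstOccurrences v).map (fun p => (p.1, evalFrom M.mul f none p.2)) =
      (firstOccurrences w).map (fun p => (p.1, evalFrom M.mul f none p.2))) :
    v.head? = w.head? ∧ evalFrom M.mul f none v.tail = evalFrom M.mul f none w.tail := by
  cases v with
  | nil => cases w with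
    | nil => exact ⟨rfl, rfl⟩
    | cons b w => rw [firstOccurrences_cons] at h; simp [firstOccurrences, splitSeen] at h
  | cons a v => cases w with
    | nil => rw [firstOccurrences_cons] at h; simp [firstOccurrences, splitSeen] at h
    | cons b w =>
      rw [firstOccurrences_cons, firstOccurrences_cons, List.map_cons, List.map_cons,
        List.cons.injEq, Prod.mk.injEq] at h
      obtain ⟨⟨rfl, h2⟩, h3⟩ := h
      refine ⟨rfl, ?_⟩
      rw [List.tail_cons, List.tail_cons]
      conv_lhs => rw [← splitSeen_flatMap {a} v]
      conv_rhs => rw [← splitSeen_flatMap {a} w]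
      rw [evalFrom_append, evalFrom_append]
      dsimp only at h2
      rw [h2]
      exact evalFrom_flatMap_congr M f h3 _

end

/-! ## Tables -/

section

variable {k nf nw : ℕ}

/-- The table of a binary operation. -/
def opTable (mul : Fin nf → Fin nf → Fin nf) : List (List ℕ) :=
  List.ofFn fun a => List.ofFn fun b => (mul a b : ℕ)

/-- The list of values of an assignment. -/
def valTable (f : Fin k → Fin nf) : List ℕ := List.ofFn fun a => (f a : ℕ)

theorem valTable_getD (f : Fin k → Fin nf) (a : Fin k) : (valTable f).getD a 0 = f a := by
  rw [valTable, List.getD_eq_getElem _ _ (by simp)]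
  simp

theorem opTable_getD (mul : Fin nf → Fin nf → Fin nf) (x y : Fin nf) :
    ((opTable mul).getD x []).getD y 0 = mul x y := by
  have h : (opTable mul).getD x [] = List.ofFn fun b => (mul x b : ℕ) := by
    rw [opTable, List.getD_eq_getElem _ _ (by simp)]
    simp
  rw [h, List.getD_eq_getElem _ _ (by simp)]
  simp

theorem evalTable_eq (mul : Fin nf → Fin nf → Fin nf) (f : Fin k → Fin nf)
    (acc : Option (Fin nf)) (w : List (Fin k)) :
    evalTable (opTable mul) (valTable f) (acc.map Fin.val) (w.map Fin.val) =
      (evalFrom mul f acc w).map Fin.val := by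
  induction w generalizing acc with
  | nil => rfl
  | cons b w ih =>
    rw [evalFrom_cons, ← ih]
    simp only [evalTable, List.map_cons, List.foldl_cons, valTable_getD]
    congr 1
    cases acc with
    | none => rfl
    | some x => exact congrArg some (opTable_getD mul x (f b))

/-- The step function of `segmentsTable`. -/
def segmentStep (t : List (List ℕ)) (f : List ℕ) (acc : List (ℕ × Option ℕ)) (b : ℕ) :
    List (ℕ × Option ℕ) :=
  bif acc.any fun p => decide (p.1 = b) then
    ((acc.head?.getD (0, none)).1, evalTable t f (acc.head?.getD (0, none)).2 [b]) :: acc.tail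
  else (b, none) :: acc

theorem segmentsTable_append (t : List (List ℕ)) (f v w : List ℕ) :
    segmentsTable t f (v ++ w) = w.foldl (segmentStep t f) (segmentsTable t f v) :=
  List.foldl_append

theorem foldl_segmentStep (mul : Fin nf → Fin nf → Fin nf) (f : Fin k → Fin nf) (w : List (Fin k))
    (seen : Finset (Fin k)) (b : ℕ) (o : Option (Fin nf)) (acc : List (ℕ × Option ℕ))
    (hseen : ∀ x : Fin k, x ∈ seen ↔ ∃ p ∈ (b, o.map Fin.val) :: acc, p.1 = x) :
    (w.map Fin.val).foldl (segmentStep (opTable mul) (valTable f)) ((b, o.map Fin.val) :: acc) =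
      ((splitSeen seen w).2.map fun p =>
        ((p.1 : ℕ), (evalFrom mul f none p.2).map Fin.val)).reverse ++
      (b, (evalFrom mul f o (splitSeen seen w).1).map Fin.val) :: acc := by
  induction w generalizing seen b o acc with
  | nil => rfl
  | cons x w ih =>
    rw [List.map_cons, List.foldl_cons, splitSeen]
    split_ifs with hx
    · have h1 : segmentStep (opTable mul) (valTable f) ((b, o.map Fin.val) :: acc) x =
          (b, (evalFrom mul f o [x]).map Fin.val) :: acc := by
        have : (((b, o.map Fin.val) :: acc).any fun p => decide (p.1 = x)) = true := by
          simpa only [List.any_eq_true, decide_eq_true_eq] using (hseen x).1 hx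
        rw [segmentStep, this, cond_true, ← evalTable_eq]
        rfl
      rw [h1, ih seen b _ acc (fun y => by rw [hseen y]; simp)]
      rfl
    · have h1 : segmentStep (opTable mul) (valTable f) ((b, o.map Fin.val) :: acc) x =
          ((x : ℕ), (none : Option (Fin nf)).map Fin.val) :: (b, o.map Fin.val) :: acc := by
        have : (((b, o.map Fin.val) :: acc).any fun p => decide (p.1 = x)) = false := by
          rw [Bool.eq_false_iff]
          intro h
          exact hx ((hseen x).2 (by simpa only [List.any_eq_true, decide_eq_true_eq] using h))
        rw [segmentStep, this, cond_false]
        rfl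
      rw [h1, ih (insert x seen) x none _ fun y => ?_]
      · simp
      · rw [Finset.mem_insert, hseen y]
        simp only [List.mem_cons, exists_eq_or_imp, Fin.val_inj, eq_comm]

/-- `segmentsTable` computes the segments of a word. -/
theorem segmentsTable_eq (mul : Fin nf → Fin nf → Fin nf) (f : Fin k → Fin nf) (w : List (Fin k)) :
    segmentsTable (opTable mul) (valTable f) (w.map Fin.val) =
      ((firstOccurrences w).map fun p =>
        ((p.1 : ℕ), (evalFrom mul f none p.2).map Fin.val)).reverse := by
  cases w with
  | nil => rfl
  | cons b w =>
    rw [firstOccurrences_cons]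
    have := foldl_segmentStep mul f w {b} b none [] fun y => by simp [eq_comm, Fin.val_inj]
    simp only [List.map_cons, List.reverse_cons]
    exact this

theorem mem_assignments_iff {l : List ℕ} :
    l ∈ tuples (List.range nf) k ↔ ∃ f : Fin k → Fin nf, valTable f = l := by
  rw [mem_tuples]
  constructor
  · rintro ⟨rfl, h⟩
    refine ⟨fun i => ⟨l[i], List.mem_range.1 (h _ (List.getElem_mem _))⟩, ?_⟩
    exact List.ofFn_getElem
  · rintro ⟨f, rfl⟩
    refine ⟨by simp [valTable], fun x hx => ?_⟩
    obtain ⟨i, rfl⟩ := (List.mem_ofFn' _ _).1 hx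
    simp

end

/-! ## Substitutions -/

/-- The substitution with the given images of the letters. -/
def Substitution.ofImages {A : Type*} (g : A → List A) (hg : ∀ a, g a ≠ []) : Substitution A where
  toHom := FreeMonoid.lift fun a => FreeMonoid.ofList (g a)
  nonerasing v := by
    refine ⟨fun h => ?_, fun h => by rw [h, map_one]⟩
    cases v with
    | one => rfl
    | of_mul a v =>
      rw [map_mul, FreeMonoid.lift_eval_of] at h
      have h' : g a ++ (FreeMonoid.lift (fun a => FreeMonoid.ofList (g a)) v).toList = [] := h
      exact absurd (List.append_eq_nil_iff.1 h').1 (hg a)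

theorem Substitution.image_ofImages {A : Type*} (g : A → List A) (hg : ∀ a, g a ≠ []) (a : A) :
    (Substitution.ofImages g hg).image a = g a := by
  rw [Substitution.image, Substitution.ofImages, FreeMonoid.lift_eval_of]
  rfl

theorem Substitution.image_ne_nil {A : Type*} (σ : Substitution A) (a : A) : σ.image a ≠ [] := by
  intro h
  have h1 : FreeMonoid.of a = 1 := (σ.nonerasing (FreeMonoid.of a)).1 h
  exact List.cons_ne_nil a [] h1

/-! ## Representatives of the classes of substitutions -/

/-- If the prefixes of words have finitely many states, and the state of a word is determined by
the state of a prefix and the remaining word, then all states are reached by short words. -/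
theorem exists_short_word {A σ : Type*} (S : List A → σ) (V : List σ)
    (hV : ∀ w, S w ∈ V) (hS : ∀ u u' v, S u = S u' → S (u ++ v) = S (u' ++ v)) (w : List A) :
    ∃ w', w'.length ≤ V.length ∧ S w' = S w := by
  classical
  induction hn : w.length using Nat.strong_induction_on generalizing w with
  | _ n ih =>
    subst hn
    by_cases hw : w.length ≤ V.length
    · exact ⟨w, hw, rfl⟩
    · obtain ⟨i, hi, j, hj, hne, heq⟩ := Finset.exists_ne_map_eq_of_card_lt_of_maps_to
        (s := Finset.range (w.length + 1)) (t := V.toFinset) (f := fun i => S (w.take i))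
        (by
          have := V.toFinset_card_le
          rw [Finset.card_range]; omega)
        (fun j _ => by simpa using hV _)
      wlog hij : i < j generalizing i j
      · exact this j hj i hi hne.symm heq.symm (by omega)
      simp only [Finset.mem_range] at hi hj
      obtain ⟨w', h1, h2⟩ := ih (w.take i ++ w.drop j).length
        (by rw [List.length_append, List.length_take, List.length_drop]; omega) _ rfl
      refine ⟨w', h1, h2.trans ?_⟩
      rw [hS _ _ (w.drop j) heq, List.take_append_drop]

section

variable {k nf nw : ℕ} {M : OmegaSemigroup (Fin nf) (Fin nw)} (h : WordHom (Fin k) M)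

theorem HomCode.wordSignature_eq_iff (v w : List ℕ) :
    h.code.wordSignature v = h.code.wordSignature w ↔ ∀ f : Fin k → Fin nf,
      segmentsTable (opTable M.mul) (valTable f) v =
        segmentsTable (opTable M.mul) (valTable f) w := by
  rw [HomCode.wordSignature, HomCode.wordSignature, List.map_inj_left]
  exact ⟨fun H f => H _ (mem_assignments_iff.2 ⟨f, rfl⟩),
    fun H l hl => by obtain ⟨f, rfl⟩ := mem_assignments_iff.1 hl; exact H f⟩

/-- The code of an element of the finite part with a neutral element adjoined. -/
def optVal (o : WithOne (Fin nf)) : Option ℕ := Option.map Fin.val (show Option (Fin nf) from o)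

theorem optVal_injective : Function.Injective (optVal (nf := nf)) :=
  Option.map_injective Fin.val_injective

theorem segments_eq_iff (v w : List (Fin k)) (g : WordHom (Fin k) M) :
    ((firstOccurrences v).map fun p => (p.1, WordHom.eval g p.2)) =
      ((firstOccurrences w).map fun p => (p.1, WordHom.eval g p.2)) ↔
    segmentsTable (opTable M.mul) (valTable g.letter) (v.map Fin.val) =
      segmentsTable (opTable M.mul) (valTable g.letter) (w.map Fin.val) := by
  have key : ∀ v : List (Fin k),
      ((firstOccurrences v).map fun p => (p.1, WordHom.eval g p.2)).map
        (Prod.map Fin.val optVal) =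
      (firstOccurrences v).map fun p =>
        ((p.1 : ℕ), (evalFrom M.mul g.letter none p.2).map Fin.val) := by
    intro v
    rw [List.map_map]
    refine List.map_congr_left fun p _ => ?_
    rw [← WordHom.eval_eq]
    rfl
  rw [segmentsTable_eq, segmentsTable_eq, List.reverse_inj, ← key, ← key]
  refine ⟨fun h => by rw [h], fun h => List.map_injective_iff.2 ?_ h⟩
  exact Function.Injective.prodMap Fin.val_injective optVal_injective

/-- Two substitutions are equivalent if and only if the images of the letters have the same
signatures. -/
theorem equiv_iff_signature (σ μ : Substitution (Fin k)) : substSetoid (Fin k) M σ μ ↔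
    ∀ a, h.code.wordSignature ((σ.image a).map Fin.val) =
      h.code.wordSignature ((μ.image a).map Fin.val) := by
  simp only [HomCode.wordSignature_eq_iff]
  constructor
  · intro H a f
    exact (segments_eq_iff _ _ (WordHom.ofLetters M f)).1 (H a _)
  · intro H a g
    exact (segments_eq_iff _ _ g).2 (H a g.letter)

theorem equiv_iff_codeSignature (σ μ : Substitution (Fin k)) : substSetoid (Fin k) M σ μ ↔
    σ.code.map h.code.wordSignature = μ.code.map h.code.wordSignature := by
  rw [equiv_iff_signature h, Substitution.code, Substitution.code, List.map_ofFn, List.map_ofFn,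
    List.ofFn_inj, funext_iff]
  rfl

theorem wordSignature_mem (w : List (Fin k)) : h.code.wordSignature (w.map Fin.val) ∈
    tuples h.code.segmentLists h.code.assignments.length := by
  rw [mem_tuples]
  refine ⟨by simp [HomCode.wordSignature], fun x hx => ?_⟩
  obtain ⟨l, hl, rfl⟩ := List.mem_map.1 hx
  obtain ⟨f, rfl⟩ := mem_assignments_iff (k := k) (nf := nf).1 hl
  change segmentsTable (opTable M.mul) _ _ ∈ _
  rw [segmentsTable_eq, HomCode.segmentLists, List.mem_flatMap]
  have hlen : (firstOccurrences w).length ≤ k := by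
    have := (splitSeen_nodup ∅ w).1.length_le_card
    simpa [firstOccurrences] using this
  refine ⟨(firstOccurrences w).length, List.mem_range.2 (Nat.lt_succ_of_le hlen), ?_⟩
  rw [mem_tuples]
  refine ⟨by simp, fun x hx => ?_⟩
  obtain ⟨p, -, rfl⟩ := List.mem_map.1 (List.mem_reverse.1 hx)
  refine List.mem_flatMap.2 ⟨p.1, List.mem_range.2 p.1.2, List.mem_map.2 ⟨_, ?_, rfl⟩⟩
  rw [HomCode.optElements, List.mem_cons]
  cases evalFrom M.mul f none p.2 with
  | none => exact Or.inl rfl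
  | some x => exact Or.inr (List.mem_map.2 ⟨x, List.mem_range.2 x.2, rfl⟩)

theorem segmentsTable_ne_nil (mul : Fin nf → Fin nf → Fin nf) (f : Fin k → Fin nf)
    {w : List (Fin k)} (hw : w ≠ []) :
    segmentsTable (opTable mul) (valTable f) (w.map Fin.val) ≠ [] := by
  cases w with
  | nil => exact absurd rfl hw
  | cons b w => rw [segmentsTable_eq, firstOccurrences_cons]; simp

theorem mem_shortWords {w : List ℕ} : w ∈ h.code.shortWords ↔
    ∃ v : List (Fin k), v ≠ [] ∧ v.length ≤ h.code.signatureBound ∧ v.map Fin.val = w := by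
  rw [HomCode.shortWords, List.mem_filter, List.mem_flatMap, decide_eq_true_eq]
  constructor
  · rintro ⟨⟨l, hl, hw⟩, hpos⟩
    obtain ⟨rfl, hw'⟩ := mem_tuples.1 hw
    refine ⟨w.pmap (fun x hx => ⟨x, hx⟩) fun x hx => List.mem_range.1 (hw' x hx), ?_, ?_, ?_⟩
    · rw [← List.length_pos_iff, List.length_pmap]; exact hpos
    · rw [List.length_pmap]; exact Nat.lt_succ_iff.1 (List.mem_range.1 hl)
    · rw [List.map_pmap]; simp
  · rintro ⟨v, hv, hl, rfl⟩
    refine ⟨⟨v.length, List.mem_range.2 (Nat.lt_succ_of_le hl), mem_tuples.2 ⟨by simp, ?_⟩⟩, ?_⟩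
    · intro x hx
      obtain ⟨y, -, rfl⟩ := List.mem_map.1 hx
      exact List.mem_range.2 y.2
    · rw [List.length_map]; exact List.length_pos_iff.2 hv

theorem exists_shortWord {w : List (Fin k)} (hw : w ≠ []) : ∃ w' : List (Fin k), w' ≠ [] ∧
    w'.map Fin.val ∈ h.code.shortWords ∧
    h.code.wordSignature (w'.map Fin.val) = h.code.wordSignature (w.map Fin.val) := by
  obtain ⟨w', h1, h2⟩ := exists_short_word
    (fun w : List (Fin k) => h.code.wordSignature (w.map Fin.val)) _ (wordSignature_mem h)
    (fun u u' v H => by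
      rw [HomCode.wordSignature_eq_iff] at H ⊢
      intro f
      rw [List.map_append, List.map_append, segmentsTable_append, segmentsTable_append, H f]) w
  have hw' : w' ≠ [] := by
    rintro rfl
    have := (HomCode.wordSignature_eq_iff h _ _).1 h2 h.letter
    exact segmentsTable_ne_nil M.mul h.letter hw this.symm
  exact ⟨w', hw', (mem_shortWords h).2 ⟨w', hw', h1, rfl⟩, h2⟩

theorem exists_code_of_mem_tuples {s : SubstCode} (hs : s ∈ tuples h.code.shortWords k) :
    ∃ σ : Substitution (Fin k), σ.code = s := by
  obtain ⟨rfl, hs⟩ := mem_tuples.1 hs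
  choose g hg1 _ hg3 using fun i : Fin s.length => (mem_shortWords h).1 (hs s[i] (List.getElem_mem _))
  refine ⟨Substitution.ofImages g hg1, ?_⟩
  rw [Substitution.code]
  simp only [Substitution.image_ofImages, hg3]
  exact List.ofFn_getElem

theorem exists_mem_tuples_equiv (σ : Substitution (Fin k)) : ∃ μ : Substitution (Fin k),
    μ.code ∈ tuples h.code.shortWords k ∧ substSetoid (Fin k) M μ σ := by
  choose g hg1 hg2 hg3 using fun a => exists_shortWord h (σ.image_ne_nil a)
  refine ⟨Substitution.ofImages g hg1, mem_tuples.2 ⟨by simp [Substitution.code], ?_⟩,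
    (equiv_iff_signature h _ _).2 fun a => ?_⟩
  · intro x hx
    obtain ⟨a, rfl⟩ := (List.mem_ofFn' _ _).1 hx
    simp only [Substitution.image_ofImages]
    exact hg2 a
  · rw [Substitution.image_ofImages]
    exact hg3 a

theorem representatives_spec : ∃ rep : Xi (Fin k) M → Substitution (Fin k),
    (∀ ξ, (rep ξ).cls M = ξ) ∧ h.code.representatives.Nodup ∧
      ∀ w, w ∈ h.code.representatives ↔ ∃ ξ, (rep ξ).code = w := by
  set L := (tuples h.code.shortWords k).map fun s =>
    (s.map fun w => h.code.wordSignature w, s) with hL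
  obtain ⟨hD1, hD2, hD3⟩ := dedupKeys_spec L
  have hR : h.code.representatives = (dedupKeys L).map Prod.snd := rfl
  have hkey : ∀ p ∈ dedupKeys L, p.1 = p.2.map h.code.wordSignature ∧
      p.2 ∈ tuples h.code.shortWords k := by
    intro p hp
    obtain ⟨s, hs, rfl⟩ := List.mem_map.1 (hD1 p hp)
    exact ⟨rfl, hs⟩
  have hsig : (h.code.representatives.map (List.map h.code.wordSignature)).Nodup := by
    rw [hR, List.map_map]
    convert hD2 using 1
    exact List.map_congr_left fun p hp => (hkey p hp).1.symm
  have hex : ∀ ξ : Xi (Fin k) M, ∃ μ : Substitution (Fin k), μ.cls M = ξ ∧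
      μ.code ∈ h.code.representatives := by
    intro ξ
    induction ξ using Quotient.inductionOn with
    | h σ =>
      obtain ⟨μ, hμ, hμσ⟩ := exists_mem_tuples_equiv h σ
      obtain ⟨p, hp, hpμ⟩ := List.mem_map.1 (hD3 _ (List.mem_map.2 ⟨_, hμ, rfl⟩))
      obtain ⟨hp1, hp2⟩ := hkey p hp
      obtain ⟨ν, hν⟩ := exists_code_of_mem_tuples h hp2
      refine ⟨ν, Quotient.sound ?_, ?_⟩
      · refine (substSetoid (Fin k) M).iseqv.trans ?_ hμσ
        rw [← hν] at hp1
        exact (equiv_iff_codeSignature h _ _).2 (hp1.symm.trans hpμ)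
      · rw [hR, hν]; exact List.mem_map.2 ⟨p, hp, rfl⟩
  choose rep hrep1 hrep2 using hex
  refine ⟨rep, hrep1, hsig.of_map _, fun w => ⟨fun hw => ?_, ?_⟩⟩
  · have hw' := hw
    rw [hR] at hw'
    obtain ⟨p, hp, rfl⟩ := List.mem_map.1 hw'
    obtain ⟨ν, hν⟩ := exists_code_of_mem_tuples h (hkey p hp).2
    refine ⟨ν.cls M, ?_⟩
    refine List.inj_on_of_nodup_map hsig (hrep2 _) hw ?_
    rw [← hν]
    exact (equiv_iff_codeSignature h _ _).1 (Quotient.exact (hrep1 (ν.cls M)))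
  · rintro ⟨ξ, rfl⟩
    exact hrep2 ξ

/-- Equivalent substitutions agree on the first letters of images and on the values of the
remaining words. -/
theorem head_tail_of_equiv {σ μ : Substitution (Fin k)} (H : substSetoid (Fin k) M σ μ) (a : Fin k)
    (f : Fin k → Fin nf) : (σ.image a).head? = (μ.image a).head? ∧
      evalFrom M.mul f none (σ.image a).tail = evalFrom M.mul f none (μ.image a).tail := by
  refine head_tail_of_segments M f ?_
  have h1 := H a (WordHom.ofLetters M f)
  have h2 : ∀ v : List (Fin k),
      ((firstOccurrences v).map fun p => (p.1, WordHom.eval (WordHom.ofLetters M f) p.2)) =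
      ((firstOccurrences v).map fun p => (p.1, evalFrom M.mul f none p.2)) := fun v =>
    List.map_congr_left fun p _ => by
      rw [← WordHom.letter_ofLetters M f, ← WordHom.eval_eq]
      rfl
  rw [← h2, ← h2]
  exact h1

end

/-! ## Runs of the phases -/

section

variable {A F W : Type*}

/-- The concatenation `u 0 ⋯ u (n-1)`. -/
def cat (u : ℕ → List A) : ℕ → List A
  | 0 => []
  | n + 1 => cat u n ++ u n

theorem cat_add (u : ℕ → List A) (i l : ℕ) :
    cat u (i + l) = cat u i ++ cat (fun j => u (i + j)) l := by
  induction l with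
  | zero => simp [cat]
  | succ l ih => rw [← add_assoc, cat, ih, cat, List.append_assoc]

/-- An additive form of Ramsey's theorem. -/
theorem exists_monochromatic_steps [Finite F] (S : ℕ → ℕ → Option F)
    (hS : ∀ i, ∀ᶠ j in Filter.atTop, (S i j).isSome) :
    ∃ (e : F) (idx : ℕ → ℕ), StrictMono idx ∧ 0 < idx 0 ∧
      ∀ i, S (idx i) (idx (i + 1)) = some e := by
  let U : Ultrafilter ℕ := Filter.hyperfilter ℕ
  have hU : (U : Filter ℕ) ≤ Filter.atTop := by
    rw [← Nat.cofinite_eq_atTop]; exact Filter.hyperfilter_le_cofinite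
  have hc : ∀ i, ∃ c : F, ∀ᶠ j in (U : Filter ℕ), S i j = some c := by
    intro i
    obtain ⟨a, ha⟩ := (U.map (S i)).eq_pure_of_finite
    have h1 : ∀ᶠ j in (U : Filter ℕ), S i j = a := by
      have : ({a} : Set (Option F)) ∈ U.map (S i) := by rw [ha]; exact rfl
      exact this
    obtain ⟨j, hj1, hj2⟩ := (h1.and (hU (hS i))).exists
    cases a with
    | none => rw [hj1] at hj2; cases hj2
    | some c => exact ⟨c, h1⟩
  choose c hc using hc
  obtain ⟨e, he⟩ := (U.map c).eq_pure_of_finite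
  have h1 : ∀ᶠ j in (U : Filter ℕ), c j = e := by
    have : ({e} : Set F) ∈ U.map c := by rw [he]; exact rfl
    exact this
  have hnext : ∀ i, ∃ j, c j = e ∧ i < j ∧ (c i = e → S i j = some e) := by
    intro i
    obtain ⟨j, ⟨hj1, hj2⟩, hj3⟩ := ((h1.and (hU (Filter.eventually_gt_atTop i))).and (hc i)).exists
    exact ⟨j, hj1, hj2, fun h => by rw [hj3, h]⟩
  choose next hn1 hn2 hn3 using hnext
  have hidx : ∀ i, c (next^[i + 1] 0) = e := fun i => by
    rw [Function.iterate_succ_apply']; exact hn1 _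
  refine ⟨e, fun i => next^[i + 1] 0, strictMono_nat_of_lt_succ fun i => ?_, hn2 0, fun i => ?_⟩
  · rw [Function.iterate_succ_apply' next (i + 1)]; exact hn2 _
  · beta_reduce
    rw [Function.iterate_succ_apply' next (i + 1)]; exact hn3 _ (hidx i)

/-- The transitions between the phases, when the generated word is extended by a word with right
action `ev` on the elements of the finite part. -/
def PhaseStep (M : OmegaSemigroup F W) (T : Set F × Set W) (ev : Option F → Option F)
    (m m' : ℕ × F × Option F) : Prop :=
  (m.1 = 0 ∧ m'.1 = 0 ∧ some m'.2.1 = ev (some m.2.1)) ∨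
  (m.1 ≤ 1 ∧ m'.1 = 1 ∧ ev none = none ∧ m.2.1 ∈ T.1 ∧ m'.2.1 = m.2.1) ∨
  (m.1 = 0 ∧ m'.1 = 2 ∧ m'.2.2 = none ∧
    ∃ p, ev (some m.2.1) = some p ∧ M.mixed p (M.prod fun _ => m'.2.1) ∈ T.2) ∨
  (2 ≤ m.1 ∧ m'.1 = 2 ∧ m'.2.1 = m.2.1 ∧ m'.2.2 = ev m.2.2) ∨
  (2 ≤ m.1 ∧ m'.1 = 3 ∧ m'.2.1 = m.2.1 ∧ m'.2.2 = none ∧ ev m.2.2 = some m.2.1)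

/-- There is an accepting sequence of phases that starts with the value `x`. -/
def PhaseRun (M : OmegaSemigroup F W) (T : Set F × Set W) (ev : ℕ → Option F → Option F)
    (x : F) : Prop :=
  ∃ m : ℕ → ℕ × F × Option F, (m 0).1 = 0 ∧ (m 0).2.1 = x ∧
    (∀ n, PhaseStep M T (ev n) (m n) (m (n + 1))) ∧
    ∀ N, ∃ n ≥ N, (m n).1 = 1 ∨ (m n).1 = 3

theorem IsWordLimit.unique {u : ℕ → List A} {β β' : ℕ → A} (h : IsWordLimit u (Sum.inr β))
    (h' : IsWordLimit u (Sum.inr β')) : β = β' := by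
  funext j
  obtain ⟨N, hN⟩ := h (j + 1)
  obtain ⟨N', hN'⟩ := h' (j + 1)
  have := (hN _ (le_max_left N N')).symm.trans (hN' _ (le_max_right N N'))
  exact congrFun (List.ofFn_inj.1 this) ⟨j, Nat.lt_succ_self j⟩

theorem isWordLimit_of_initial_words {u : ℕ → List A} {β : ℕ → A}
    (h : ∀ j, ∃ v : List A, j ≤ v.length ∧ (∀ i (hi : i < v.length), v[i] = β i) ∧
      ∃ N, ∀ n ≥ N, v <+: u n) : IsWordLimit u (Sum.inr β) := by
  intro j
  obtain ⟨v, hj, hv, N, hN⟩ := h j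
  refine ⟨N, fun n hn => ?_⟩
  obtain ⟨t, ht⟩ := hN n hn
  rw [← ht, List.take_append_of_le_length hj]
  refine List.ext_getElem (by simp [hj]) fun i h1 h2 => ?_
  rw [List.getElem_take, List.getElem_ofFn]
  exact hv _ _

theorem prepend_infConcat_getElem (w : FinWord A) (v : ℕ → FinWord A) (n i : ℕ)
    (hi : i < (w.1 ++ FinWord.flat v n).length) :
    (w.1 ++ FinWord.flat v n)[i] = w.prepend (FinWord.infConcat v) i := by
  rw [FinWord.prepend]
  split_ifs with h
  · exact List.getElem_append_left h
  · rw [List.getElem_append_right (not_lt.1 h)]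
    have h' : i - w.1.length < (FinWord.flat v n).length := by
      rw [List.length_append] at hi; omega
    have := FinWord.flat_getElem? v h'
    rw [List.getElem?_eq_getElem h'] at this
    exact Option.some.inj this

variable {M : OmegaSemigroup F W} (h : WordHom A M) (b : A) (u : ℕ → List A)

/-- The limit of `b u₀ ⋯ uₙ` if the word is cut into factors of value `e`. -/
theorem exists_limit_of_factors {e : F} {idx : ℕ → ℕ} (hidx : StrictMono idx)
    (he : ∀ i, evalFrom M.mul h.letter none
      (cat (fun j => u (idx i + j)) (idx (i + 1) - idx i)) = some e) :
    ∃ β : ℕ → A, IsWordLimit (fun n => b :: cat u (n + 1)) (Sum.inr β) ∧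
      h.inf β = M.mixed (h.fin ⟨b :: cat u (idx 0), List.cons_ne_nil _ _⟩)
        (M.prod fun _ => e) := by
  set v : ℕ → FinWord A := fun i => ⟨cat (fun j => u (idx i + j)) (idx (i + 1) - idx i), fun hc => by
    have := he i
    rw [hc] at this
    cases this⟩ with hv
  set w : FinWord A := ⟨b :: cat u (idx 0), List.cons_ne_nil _ _⟩ with hw
  have hflat : ∀ i, w.1 ++ FinWord.flat v i = b :: cat u (idx i) := by
    intro i
    induction i with
    | zero => simp [FinWord.flat, hw]
    | succ i ih =>
      have hlt := hidx (Nat.lt_succ_self i)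
      rw [FinWord.flat, ← List.append_assoc, ih, List.cons_append]
      change b :: (cat u (idx i) ++ cat (fun j => u (idx i + j)) (idx (i + 1) - idx i)) = _
      rw [← cat_add, Nat.add_sub_cancel' (show idx i ≤ idx (i + 1) from hlt.le)]
  refine ⟨w.prepend (FinWord.infConcat v), isWordLimit_of_initial_words fun j => ?_, ?_⟩
  · refine ⟨w.1 ++ FinWord.flat v j, ?_, prepend_infConcat_getElem w v j, idx j, fun n hn => ?_⟩
    · have := FinWord.le_length_flat v j
      rw [List.length_append]; omega
    · rw [hflat]
      refine ⟨cat (fun l => u (idx j + l)) (n + 1 - idx j), ?_⟩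
      rw [List.cons_append, ← cat_add, Nat.add_sub_cancel' (by omega)]
  · refine (h.map_mixed w (FinWord.infConcat v)).trans (congrArg _ ((h.map_prod v).trans ?_))
    congr 1
    funext i
    exact Option.some.inj ((h.some_fin (v i)).trans (he i))

theorem evalFrom_cat_succ (mul : F → F → F) (f : A → F) (i l : ℕ) :
    evalFrom mul f none (cat (fun j => u (i + j)) (l + 1)) =
      evalFrom mul f (evalFrom mul f none (cat (fun j => u (i + j)) l)) (u (i + l)) := by
  rw [cat, evalFrom_append]

theorem some_fin_cat_succ (n : ℕ) :
    some (h.fin ⟨b :: cat u (n + 1), List.cons_ne_nil _ _⟩) =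
      evalFrom M.mul h.letter (some (h.fin ⟨b :: cat u n, List.cons_ne_nil _ _⟩)) (u n) := by
  rw [h.some_fin, h.some_fin, ← evalFrom_append]
  rfl

/-- An accepting run yields a limit with a value in the target. -/
theorem exists_limit_of_phaseRun {T : Set F × Set W}
    (H : PhaseRun M T (fun n acc => evalFrom M.mul h.letter acc (u n)) (h.letter b)) :
    ∃ α, IsWordLimit (fun n => b :: cat u (n + 1)) α ∧
      Sum.elim (· ∈ T.1) (· ∈ T.2) (h.app α) := by
  obtain ⟨m, hm0, hmx, hm, hacc⟩ := H
  have hval : ∀ n, (m n).1 ≤ 1 → (m n).2.1 = h.fin ⟨b :: cat u n, List.cons_ne_nil _ _⟩ := by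
    intro n
    induction n with
    | zero => intro _; exact hmx
    | succ n ih =>
      intro hn
      apply Option.some.inj
      rcases hm n with ⟨h1, h2, h3⟩ | ⟨h1, h2, h3, h4, h5⟩ | ⟨h1, h2, -⟩ | ⟨h1, h2, -⟩ | ⟨h1, h2, -⟩
      · rw [some_fin_cat_succ, ← ih (by omega), h3]
      · have hu := (evalFrom_none_eq_none_iff _ _).1 h3
        rw [some_fin_cat_succ, ← ih h1, hu, evalFrom_nil, h5]
      all_goals omega
  by_cases h1 : ∃ n, (m n).1 = 1
  · obtain ⟨n, hn⟩ := h1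
    have hstay : ∀ j, (m (n + j)).1 = 1 ∧ cat u (n + j) = cat u n := by
      intro j
      induction j with
      | zero => exact ⟨hn, rfl⟩
      | succ j ih =>
        rcases hm (n + j) with ⟨h1, -⟩ | ⟨h1, h2, h3, h4, h5⟩ | ⟨h1, h2, -⟩ | ⟨h1, h2, -⟩ |
          ⟨h1, h2, -⟩
        · omega
        · refine ⟨h2, ?_⟩
          rw [← add_assoc, cat, (evalFrom_none_eq_none_iff _ _).1 h3, List.append_nil, ih.2]
        all_goals omega
    refine ⟨Sum.inl ⟨b :: cat u n, List.cons_ne_nil _ _⟩, ⟨n, fun j hj => ?_⟩, ?_⟩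
    · have := (hstay (j + 1 - n)).2
      rw [Nat.add_sub_cancel' (by omega)] at this
      exact congrArg (b :: ·) this
    · change h.fin _ ∈ T.1
      rw [← hval n hn.le]
      rcases hm n with ⟨h1, -⟩ | ⟨-, -, -, h4, -⟩ | ⟨h1, -⟩ | ⟨h1, -⟩ | ⟨h1, -⟩
      · omega
      · exact h4
      all_goals omega
  · have hacc' : ∀ N, ∃ n ≥ N, (m n).1 = 3 := fun N => by
      obtain ⟨n, hn, h2⟩ := hacc N
      exact ⟨n, hn, h2.resolve_left fun h3 => h1 ⟨n, h3⟩⟩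
    have hex : ∃ n, 2 ≤ (m n).1 := by
      obtain ⟨n, -, hn⟩ := hacc' 0
      exact ⟨n, by omega⟩
    obtain ⟨N, hN⟩ : ∃ N, Nat.find hex = N + 1 := by
      refine ⟨Nat.find hex - 1, ?_⟩
      have h2 := Nat.find_spec hex
      have : Nat.find hex ≠ 0 := fun h0 => by rw [h0] at h2; omega
      omega
    have hN1 : 2 ≤ (m (N + 1)).1 := hN ▸ Nat.find_spec hex
    have hN0 : ¬ 2 ≤ (m N).1 := Nat.find_min hex (by omega)
    have hN0' : (m N).1 = 0 := by
      by_contra hc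
      exact h1 ⟨N, by omega⟩
    obtain ⟨p, hc0, hp, hpT⟩ : ∃ p, (m (N + 1)).2.2 = none ∧
        evalFrom M.mul h.letter (some (m N).2.1) (u N) = some p ∧
        M.mixed p (M.prod fun _ => (m (N + 1)).2.1) ∈ T.2 := by
      rcases hm N with ⟨-, h2, -⟩ | ⟨-, h2, -⟩ | ⟨-, -, h3, p, h4, h5⟩ | ⟨h2, -⟩ | ⟨h2, -⟩
      · omega
      · omega
      · exact ⟨p, h3, h4, h5⟩
      all_goals omega
    set e := (m (N + 1)).2.1 with he
    have hge : ∀ n ≥ N + 1, 2 ≤ (m n).1 ∧ (m n).2.1 = e := by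
      intro n hn
      induction n, hn using Nat.le_induction with
      | base => exact ⟨hN1, rfl⟩
      | succ n hn ih =>
        rcases hm n with ⟨h2, -⟩ | ⟨h2, -⟩ | ⟨h2, -⟩ | ⟨-, h2, h3, -⟩ | ⟨-, h2, h3, -⟩
        · omega
        · omega
        · omega
        · exact ⟨by omega, h3.trans ih.2⟩
        · exact ⟨by omega, h3.trans ih.2⟩
    have hnext : ∀ i, ∃ n, i < n ∧ (m n).1 = 3 := fun i => by
      obtain ⟨n, hn, h2⟩ := hacc' (i + 1)
      exact ⟨n, hn, h2⟩
    classical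
    set next : ℕ → ℕ := fun i => Nat.find (hnext i) with hnextdef
    set idx : ℕ → ℕ := fun i => next^[i] (N + 1) with hidxdef
    have hidx1 : ∀ i, idx (i + 1) = next (idx i) := fun i => Function.iterate_succ_apply' _ _ _
    have hidx : StrictMono idx := strictMono_nat_of_lt_succ fun i => by
      rw [hidx1]; exact (Nat.find_spec (hnext (idx i))).1
    have hidxge : ∀ i, N + 1 ≤ idx i := fun i => hidx.monotone (Nat.zero_le i)
    have hnone : ∀ i, (m (idx i)).2.2 = none := by
      intro i
      cases i with
      | zero => exact hc0
      | succ i =>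
        have h3 : (m (idx (i + 1))).1 = 3 := by
          rw [hidx1]; exact (Nat.find_spec (hnext (idx i))).2
        obtain ⟨n, hn⟩ : ∃ n, idx (i + 1) = n + 1 := ⟨idx (i + 1) - 1, by
          have := hidxge (i + 1); omega⟩
        rw [hn] at h3 ⊢
        rcases hm n with ⟨-, h2, -⟩ | ⟨-, h2, -⟩ | ⟨-, h2, -⟩ | ⟨-, h2, -⟩ | ⟨-, -, -, h2, -⟩
        · omega
        · omega
        · omega
        · omega
        · exact h2
    have hpart : ∀ i l, idx i + l < idx (i + 1) → (m (idx i + l)).2.2 =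
        evalFrom M.mul h.letter none (cat (fun j => u (idx i + j)) l) := by
      intro i l
      induction l with
      | zero => intro _; exact hnone i
      | succ l ih =>
        intro hl
        have hge' := (hge (idx i + l) (by have := hidxge i; omega)).1
        have h3 : (m (idx i + l + 1)).1 ≠ 3 := by
          intro h3
          have hl' := hl
          rw [hidx1] at hl'
          exact Nat.find_min (hnext (idx i)) hl' ⟨by omega, h3⟩
        rw [evalFrom_cat_succ, ← ih (by omega)]
        rcases hm (idx i + l) with ⟨h2, -⟩ | ⟨h2, -⟩ | ⟨h2, -⟩ | ⟨-, -, -, h2⟩ | ⟨-, h2, -⟩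
        · omega
        · omega
        · omega
        · exact h2
        · exact absurd h2 h3
    have hfac : ∀ i, evalFrom M.mul h.letter none
        (cat (fun j => u (idx i + j)) (idx (i + 1) - idx i)) = some e := by
      intro i
      have hlt : idx i < idx (i + 1) := hidx (Nat.lt_succ_self i)
      obtain ⟨l, hl⟩ : ∃ l, idx (i + 1) = idx i + l + 1 := ⟨idx (i + 1) - idx i - 1, by omega⟩
      rw [show idx (i + 1) - idx i = l + 1 by omega, evalFrom_cat_succ, ← hpart i l (by omega)]
      have hge' := hge (idx i + l) (by have := hidxge i; omega)
      have h3 : (m (idx i + l + 1)).1 = 3 := by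
        rw [← hl, hidx1]; exact (Nat.find_spec (hnext (idx i))).2
      rcases hm (idx i + l) with ⟨h2, -⟩ | ⟨h2, -⟩ | ⟨h2, -⟩ | ⟨-, h2, -⟩ | ⟨-, -, -, -, h2⟩
      · omega
      · omega
      · omega
      · omega
      · exact h2.trans (congrArg some hge'.2)
    obtain ⟨β, hβ1, hβ2⟩ := exists_limit_of_factors h b u hidx hfac
    refine ⟨Sum.inr β, hβ1, ?_⟩
    change h.inf β ∈ T.2
    rw [hβ2]
    have : h.fin ⟨b :: cat u (idx 0), List.cons_ne_nil _ _⟩ = p := by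
      apply Option.some.inj
      change some (h.fin ⟨b :: cat u (N + 1), List.cons_ne_nil _ _⟩) = _
      rw [some_fin_cat_succ, ← hval N (by omega), hp]
    rw [this]
    exact hpT

theorem phaseRun_of_finite_limit {T : Set F × Set W} {v : FinWord A}
    (hv : IsWordLimit (fun n => b :: cat u (n + 1)) (Sum.inl v)) (hT : h.fin v ∈ T.1) :
    PhaseRun M T (fun n acc => evalFrom M.mul h.letter acc (u n)) (h.letter b) := by
  obtain ⟨N, hN⟩ := hv
  have hu : ∀ n ≥ N + 1, u n = [] := by
    intro n hn
    have h1 := hN (n - 1) (by omega)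
    have h2 := hN n (by omega)
    beta_reduce at h1 h2
    rw [Nat.sub_add_cancel (by omega)] at h1
    have h3 : cat u (n + 1) = cat u n := (List.cons.inj (h2.trans h1.symm)).2
    rw [cat] at h3
    simpa using h3
  have hfv : h.fin ⟨b :: cat u (N + 1), List.cons_ne_nil _ _⟩ = h.fin v := by
    congr 1
    exact Subtype.ext (hN N le_rfl)
  refine ⟨fun n => if n ≤ N + 1 then (0, h.fin ⟨b :: cat u n, List.cons_ne_nil _ _⟩, none)
    else (1, h.fin v, none), rfl, rfl, fun n => ?_, fun K => ⟨K + N + 2, by omega, Or.inl ?_⟩⟩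
  · beta_reduce
    rcases Nat.lt_trichotomy n (N + 1) with hn | rfl | hn
    · rw [if_pos hn.le, if_pos (by omega)]
      exact Or.inl ⟨rfl, rfl, some_fin_cat_succ h b u n⟩
    · rw [if_pos le_rfl, if_neg (by omega)]
      refine Or.inr (Or.inl ⟨by simp, rfl, ?_, ?_, ?_⟩)
      · rw [hu _ le_rfl]; rfl
      · rw [hfv]; exact hT
      · exact hfv.symm
    · rw [if_neg (by omega), if_neg (by omega)]
      refine Or.inr (Or.inl ⟨le_rfl, rfl, ?_, hT, rfl⟩)
      rw [hu _ hn.le]; rfl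
  · beta_reduce
    rw [if_neg (by omega)]

theorem phaseRun_of_infinite_limit [Finite F] {T : Set F × Set W} {β : ℕ → A}
    (hβ : IsWordLimit (fun n => b :: cat u (n + 1)) (Sum.inr β)) (hT : h.inf β ∈ T.2) :
    PhaseRun M T (fun n acc => evalFrom M.mul h.letter acc (u n)) (h.letter b) := by
  obtain ⟨e, idx, hidx, hpos, he⟩ := exists_monochromatic_steps
    (fun i j => evalFrom M.mul h.letter none (cat (fun l => u (i + l)) (j - i))) fun i => by
      obtain ⟨N, hN⟩ := hβ ((cat u i).length + 2)
      refine Filter.eventually_atTop.2 ⟨max (N + 1) i, fun j hj => evalFrom_isSome _ _ _ ?_⟩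
      intro hc
      have h1 := congrArg List.length (hN (j - 1) (by have := le_max_left (N + 1) i; omega))
      have h2 := cat_add u i (j - i)
      have hij : i ≤ j := (le_max_right _ _).trans hj
      rw [hc, List.append_nil, Nat.add_sub_cancel' hij] at h2
      beta_reduce at h1
      rw [Nat.sub_add_cancel (by have := le_max_left (N + 1) i; omega), h2] at h1
      simp at h1
  obtain ⟨β', hβ1, hβ2⟩ := exists_limit_of_factors h b u hidx he
  obtain rfl := hβ.unique hβ1
  have hblock : ∀ n, ∃ i, idx 0 ≤ n → idx i ≤ n ∧ n < idx (i + 1) := by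
    intro n
    have hex : ∃ i, n < idx (i + 1) := ⟨n, lt_of_lt_of_le (Nat.lt_succ_self n) hidx.le_apply⟩
    refine ⟨Nat.find hex, fun hn => ⟨?_, Nat.find_spec hex⟩⟩
    rcases hf : Nat.find hex with _ | i
    · exact hn
    · have := Nat.find_min hex (m := i) (by omega)
      omega
  choose blk hblk using hblock
  have huniq : ∀ i n, idx i ≤ n → n < idx (i + 1) → blk n = i := by
    intro i n h1 h2
    obtain ⟨h3, h4⟩ := hblk n ((hidx.monotone (Nat.zero_le i)).trans h1)
    have h5 := hidx.lt_iff_lt.1 (lt_of_le_of_lt h1 h4)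
    have h6 := hidx.lt_iff_lt.1 (lt_of_le_of_lt h3 h2)
    omega
  refine ⟨fun n => if n < idx 0 then (0, h.fin ⟨b :: cat u n, List.cons_ne_nil _ _⟩, none)
    else (if n = idx (blk n) ∧ 0 < blk n then 3 else 2, e,
      evalFrom M.mul h.letter none (cat (fun j => u (idx (blk n) + j)) (n - idx (blk n)))),
    ?_, ?_, fun n => ?_, fun K => ⟨idx (K + 1), ?_, Or.inr ?_⟩⟩
  · simp [hpos]
  · simp only [hpos, if_true]; rfl
  · beta_reduce
    rcases Nat.lt_trichotomy (n + 1) (idx 0) with hn | hn | hn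
    · rw [if_pos (by omega), if_pos hn]
      exact Or.inl ⟨rfl, rfl, some_fin_cat_succ h b u n⟩
    · rw [if_pos (by omega), if_neg (by omega)]
      have h0 : blk (n + 1) = 0 := huniq 0 _ hn.ge (by rw [hn]; exact hidx (Nat.lt_succ_self 0))
      rw [h0, hn, Nat.sub_self]
      refine Or.inr (Or.inr (Or.inl ⟨rfl, by simp, rfl, _, (some_fin_cat_succ h b u n).symm, ?_⟩))
      rw [hβ2] at hT
      rw [← hn] at hT
      exact hT
    · rw [if_neg (show ¬ n < idx 0 by omega), if_neg (show ¬ n + 1 < idx 0 by omega)]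
      obtain ⟨h1, h2⟩ := hblk n (by omega)
      generalize hi : blk n = i at h1 h2
      have hev : evalFrom M.mul h.letter
          (evalFrom M.mul h.letter none (cat (fun j => u (idx i + j)) (n - idx i))) (u n) =
          evalFrom M.mul h.letter none (cat (fun j => u (idx i + j)) (n + 1 - idx i)) := by
        rw [show n + 1 - idx i = (n - idx i) + 1 by omega, evalFrom_cat_succ,
          Nat.add_sub_cancel' h1]
      have h2t : 2 ≤ (if n = idx i ∧ 0 < i then 3 else 2) := by split_ifs <;> omega
      rcases Nat.lt_or_ge (n + 1) (idx (i + 1)) with hlt | hge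
      · have hb : blk (n + 1) = i := huniq i _ (by omega) hlt
        rw [hb]
        refine Or.inr (Or.inr (Or.inr (Or.inl ⟨h2t, ?_, rfl, hev.symm⟩)))
        exact if_neg fun hc => by omega
      · have hn1 : n + 1 = idx (i + 1) := by omega
        have hb : blk (n + 1) = i + 1 := huniq (i + 1) _ hn1.ge (by
          rw [hn1]; exact hidx (Nat.lt_succ_self _))
        rw [hb]
        refine Or.inr (Or.inr (Or.inr (Or.inr ⟨h2t, if_pos ⟨hn1, Nat.succ_pos _⟩, rfl, ?_, ?_⟩)))
        · rw [hn1, Nat.sub_self]; rfl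
        · refine hev.trans ?_
          rw [hn1]
          exact he i
  · have : K + 1 ≤ idx (K + 1) := hidx.le_apply
    omega
  · have h1 : idx 0 ≤ idx (K + 1) := hidx.monotone (Nat.zero_le _)
    have hb : blk (idx (K + 1)) = K + 1 := huniq _ _ le_rfl (hidx (Nat.lt_succ_self _))
    beta_reduce
    rw [if_neg (by omega), hb]
    simp

theorem phaseRun_iff_exists_limit [Finite F] {T : Set F × Set W} :
    PhaseRun M T (fun n acc => evalFrom M.mul h.letter acc (u n)) (h.letter b) ↔
      ∃ α, IsWordLimit (fun n => b :: cat u (n + 1)) α ∧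
        Sum.elim (· ∈ T.1) (· ∈ T.2) (h.app α) := by
  refine ⟨exists_limit_of_phaseRun h b u, ?_⟩
  rintro ⟨v | β, h1, h2⟩
  · exact phaseRun_of_finite_limit h b u h1 h2
  · exact phaseRun_of_infinite_limit h b u h1 h2

end

/-! ## Runs of coded automata -/

theorem lt_foldr_encode {X : Type} [Encodable X] {x : X} {l : List X} (hx : x ∈ l) :
    Encodable.encode x < l.foldr (fun x n => Encodable.encode x + n) 1 := by
  have hpos : ∀ l : List X, 0 < l.foldr (fun x n => Encodable.encode x + n) 1 := by
    intro l
    induction l with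
    | nil => exact Nat.one_pos
    | cons y l ih => rw [List.foldr_cons]; omega
  induction l with
  | nil => cases hx
  | cons y l ih =>
    rw [List.foldr_cons]
    rcases List.mem_cons.1 hx with rfl | hx
    · have := hpos l
      omega
    · have := ih hx
      omega

theorem buchiOf_accepts {A X C : Type} [Encodable X] {states : List X} {letters : List C}
    {init : X → Bool} {step : X → C → X → Bool} {acc : X → Bool} (enc : A → C) (α : ℕ → A)
    (hα : ∀ n, enc (α n) ∈ letters) :
    ((buchiOf states letters init step acc).automaton enc).Accepts α ↔
      ∃ x : ℕ → X, init (x 0) = true ∧ (∀ n, x n ∈ states) ∧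
        (∀ n, step (x n) (enc (α n)) (x (n + 1)) = true) ∧ ∀ N, ∃ n ≥ N, acc (x n) = true := by
  constructor
  · rintro ⟨r, h1, h2, h3⟩
    have hstep : ∀ n, ∃ x y, x ∈ states ∧ y ∈ states ∧ Encodable.encode x = (r n : ℕ) ∧
        Encodable.encode y = (r (n + 1) : ℕ) ∧ step x (enc (α n)) y = true := by
      intro n
      have h4 : ((r n : ℕ), enc (α n), (r (n + 1) : ℕ)) ∈
          (buchiOf states letters init step acc).2.2.1 := h2 n
      simp only [buchiOf, List.mem_flatMap, List.mem_map, List.mem_filter, Prod.mk.injEq] at h4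
      obtain ⟨x, hx, l, -, y, ⟨hy, hs⟩, h5, h6, h7⟩ := h4
      exact ⟨x, y, hx, hy, h5, h7, by rwa [← h6]⟩
    choose x y hx hy hxr hyr hs using hstep
    have hyx : ∀ n, y n = x (n + 1) := fun n =>
      Encodable.encode_injective ((hyr n).trans (hxr (n + 1)).symm)
    refine ⟨x, ?_, hx, fun n => by rw [← hyx]; exact hs n, fun N => ?_⟩
    · have h4 : (r 0 : ℕ) ∈ (states.filter init).map fun x => Encodable.encode x := h1
      obtain ⟨z, hz, hzr⟩ := List.mem_map.1 h4
      rw [← Encodable.encode_injective (hzr.trans (hxr 0).symm)]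
      exact (List.mem_filter.1 hz).2
    · obtain ⟨n, hn, hr⟩ := h3 N
      have h4 : (r n : ℕ) ∈ (states.filter acc).map fun x => Encodable.encode x := hr
      obtain ⟨z, hz, hzr⟩ := List.mem_map.1 h4
      refine ⟨n, hn, ?_⟩
      rw [← Encodable.encode_injective (hzr.trans (hxr n).symm)]
      exact (List.mem_filter.1 hz).2
  · rintro ⟨x, h1, h2, h3, h4⟩
    refine ⟨fun n => ⟨Encodable.encode (x n), lt_foldr_encode (h2 n)⟩, ?_, fun n => ?_, fun N => ?_⟩
    · exact List.mem_map.2 ⟨x 0, List.mem_filter.2 ⟨h2 0, h1⟩, rfl⟩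
    · refine List.mem_flatMap.2 ⟨x n, h2 n, List.mem_flatMap.2 ⟨_, hα n, ?_⟩⟩
      exact List.mem_map.2 ⟨x (n + 1), List.mem_filter.2 ⟨h2 _, h3 n⟩, rfl⟩
    · obtain ⟨n, hn, hacc⟩ := h4 N
      exact ⟨n, hn, List.mem_map.2 ⟨x n, List.mem_filter.2 ⟨h2 n, hacc⟩, rfl⟩⟩

/-! ## Values of letters under compositions of substitutions -/

section

variable {A F W : Type*} {M : OmegaSemigroup F W} (h : WordHom A M)

/-- The values of the letters under `σ 0 ⋯ σ (n-1)`. -/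
def letterValues (σ : ℕ → Substitution A) : ℕ → A → F
  | 0 => h.letter
  | n + 1 => fun b => M.wordVal (letterValues σ n) ⟨(σ n).image b, (σ n).image_ne_nil b⟩

/-- The composition `σ 0 ⋯ σ (n-1)`. -/
def composeBelow (σ : ℕ → Substitution A) : ℕ → (FreeMonoid A →* FreeMonoid A)
  | 0 => MonoidHom.id _
  | n + 1 => (composeBelow σ n).comp (σ n).toHom

theorem composeUpTo_eq (σ : ℕ → Substitution A) (n : ℕ) :
    composeUpTo σ n = composeBelow σ (n + 1) := by
  induction n with
  | zero => rfl
  | succ n ih => rw [composeUpTo, ih]; rfl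

theorem evalFrom_hom {f g : A → F} {φ : FreeMonoid A →* FreeMonoid A}
    (H : ∀ b, some (f b) = evalFrom M.mul g none (φ (FreeMonoid.of b)).toList) (acc : Option F)
    (w : List A) :
    evalFrom M.mul f acc w = evalFrom M.mul g acc (φ (FreeMonoid.ofList w)).toList := by
  induction w generalizing acc with
  | nil =>
    have : φ (FreeMonoid.ofList []) = 1 := map_one φ
    rw [this]
    rfl
  | cons b w ih =>
    have : φ (FreeMonoid.ofList (b :: w)) = φ (FreeMonoid.of b) * φ (FreeMonoid.ofList w) :=
      map_mul φ (FreeMonoid.of b) (FreeMonoid.ofList w)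
    rw [this, FreeMonoid.toList_mul, evalFrom_append, ← ih, evalFrom_cons,
      M.evalFrom_eq_optMul g acc, ← H]
    rfl

theorem some_letterValues (σ : ℕ → Substitution A) (n : ℕ) (b : A) :
    some (letterValues h σ n b) =
      evalFrom M.mul h.letter none (composeBelow σ n (FreeMonoid.of b)).toList := by
  induction n generalizing b with
  | zero => rfl
  | succ n ih => rw [letterValues, M.some_wordVal, evalFrom_hom ih]; rfl

theorem evalFrom_letterValues (σ : ℕ → Substitution A) (n : ℕ) (acc : Option F) (w : List A) :
    evalFrom M.mul (letterValues h σ n) acc w =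
      evalFrom M.mul h.letter acc (composeBelow σ n (FreeMonoid.ofList w)).toList :=
  evalFrom_hom (some_letterValues h σ n) acc w

/-- The part of `σₙ(aₙ)` that is added to the generated word. -/
def addedTail (s : ℕ → Substitution A × A) (n : ℕ) : List A := ((s n).1.image (s n).2).tail

/-- The image of `addedTail s n` under `σ 0 ⋯ σ (n-1)`. -/
def addedWord (s : ℕ → Substitution A × A) (n : ℕ) : List A :=
  (composeBelow (fun i => (s i).1) n (FreeMonoid.ofList (addedTail s n))).toList

theorem congenial_iff {s : ℕ → Substitution A × A} :
    Congenial s ↔ ∀ n, ((s (n + 1)).1.image (s (n + 1)).2).head? = some (s n).2 := by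
  refine forall_congr' fun n => ?_
  cases (s (n + 1)).1.image (s (n + 1)).2 with
  | nil => simp
  | cons a w => simp [eq_comm]

theorem composeBelow_succ_of_head {s : ℕ → Substitution A × A} {n : ℕ} {b : A}
    (hb : ((s n).1.image (s n).2).head? = some b) :
    (composeBelow (fun i => (s i).1) (n + 1) (FreeMonoid.of (s n).2)).toList =
      (composeBelow (fun i => (s i).1) n (FreeMonoid.of b)).toList ++ addedWord s n := by
  have h1 : (s n).1.toHom (FreeMonoid.of (s n).2) =
      FreeMonoid.of b * FreeMonoid.ofList (addedTail s n) := by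
    have h2 : (s n).1.image (s n).2 = b :: addedTail s n := (List.cons_head?_tail hb).symm
    exact h2
  rw [composeBelow, MonoidHom.comp_apply, h1, map_mul, FreeMonoid.toList_mul]
  rfl

theorem composeUpTo_eq_cat {s : ℕ → Substitution A × A} (hs : Congenial s) {b : A}
    (hb : ((s 0).1.image (s 0).2).head? = some b) (n : ℕ) :
    (composeUpTo (fun i => (s i).1) n (FreeMonoid.of (s n).2)).toList =
      b :: cat (addedWord s) (n + 1) := by
  rw [composeUpTo_eq]
  induction n with
  | zero => rw [composeBelow_succ_of_head hb]; simp [cat]; rfl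
  | succ n ih =>
    rw [composeBelow_succ_of_head (congenial_iff.1 hs n), ih]
    rfl

/-- The acceptance condition in terms of the values of letters. -/
def GeneratesValue (T : Set F × Set W) (s : ℕ → Substitution A × A) : Prop :=
  Congenial s ∧ ∃ b, ((s 0).1.image (s 0).2).head? = some b ∧
    PhaseRun M T (fun n acc => evalFrom M.mul (letterValues h (fun i => (s i).1) n) acc
      (addedTail s n)) (h.letter b)

theorem generatesValue_iff [Finite F] {T : Set F × Set W} {s : ℕ → Substitution A × A} :
    GeneratesValue h T s ↔
      Congenial s ∧ ∃ α, Generates s α ∧ Sum.elim (· ∈ T.1) (· ∈ T.2) (h.app α) := by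
  refine and_congr_right fun hs => ?_
  have key : ∀ b, ((s 0).1.image (s 0).2).head? = some b →
      (PhaseRun M T (fun n acc => evalFrom M.mul (letterValues h (fun i => (s i).1) n) acc
        (addedTail s n)) (h.letter b) ↔
      ∃ α, Generates s α ∧ Sum.elim (· ∈ T.1) (· ∈ T.2) (h.app α)) := by
    intro b hb
    simp only [evalFrom_letterValues]
    refine (phaseRun_iff_exists_limit h b (addedWord s)).trans ?_
    simp only [Generates, composeUpTo_eq_cat hs hb]
  constructor
  · rintro ⟨b, hb, H⟩
    exact (key b hb).1 H
  · intro H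
    obtain ⟨b, hb⟩ := Option.isSome_iff_exists.1
      (List.isSome_head?.2 ((s 0).1.image_ne_nil (s 0).2))
    exact ⟨b, hb, (key b hb).2 H⟩

theorem evalFrom_eq_of_head_tail {f : A → F} {v w : List A} (h1 : v.head? = w.head?)
    (h2 : evalFrom M.mul f none v.tail = evalFrom M.mul f none w.tail) :
    evalFrom M.mul f none v = evalFrom M.mul f none w := by
  cases v with
  | nil => cases w with
    | nil => rfl
    | cons b w => cases h1
  | cons a v => cases w with
    | nil => cases h1
    | cons b w =>
      obtain rfl : a = b := Option.some.inj h1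
      rw [evalFrom_cons, evalFrom_cons, M.evalFrom_eq_optMul, M.evalFrom_eq_optMul f _ w]
      exact congrArg _ h2

theorem generatesValue_congr {T : Set F × Set W} {s t : ℕ → Substitution A × A}
    (h2 : ∀ n, (s n).2 = (t n).2)
    (H : ∀ n a (f : A → F), ((s n).1.image a).head? = ((t n).1.image a).head? ∧
      evalFrom M.mul f none ((s n).1.image a).tail =
        evalFrom M.mul f none ((t n).1.image a).tail) :
    GeneratesValue h T s ↔ GeneratesValue h T t := by
  have hhead : ∀ n, ((s n).1.image (s n).2).head? = ((t n).1.image (t n).2).head? := fun n => by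
    rw [h2]; exact (H n _ h.letter).1
  have hval : ∀ n, letterValues h (fun i => (s i).1) n = letterValues h (fun i => (t i).1) n := by
    intro n
    induction n with
    | zero => rfl
    | succ n ih =>
      funext b
      apply Option.some.inj
      simp only [letterValues]
      rw [M.some_wordVal, M.some_wordVal, ih]
      exact evalFrom_eq_of_head_tail (H n b h.letter).1 (H n b _).2
  have hev : (fun n acc => evalFrom M.mul (letterValues h (fun i => (s i).1) n) acc
      (addedTail s n)) = fun n acc =>
        evalFrom M.mul (letterValues h (fun i => (t i).1) n) acc (addedTail t n) := by
    funext n acc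
    rw [hval, M.evalFrom_eq_optMul, M.evalFrom_eq_optMul _ _ (addedTail t n), addedTail, addedTail,
      h2, (H n _ _).2]
  rw [GeneratesValue, GeneratesValue, hev, congenial_iff, congenial_iff]
  simp only [hhead]
  simp only [h2]

end

/-! ## Correctness of the automata -/

section

variable {k nf nw : ℕ} {M : OmegaSemigroup (Fin nf) (Fin nw)} (h : WordHom (Fin k) M)

/-- The sets of targets given by lists. -/
def targetSets (nf nw : ℕ) (T : List ℕ × List ℕ) : Set (Fin nf) × Set (Fin nw) :=
  ({x | (x : ℕ) ∈ T.1}, {w | (w : ℕ) ∈ T.2})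

/-- The code of a phase. -/
def codePhase (m : ℕ × Fin nf × Option (Fin nf)) : ℕ × ℕ × Option ℕ :=
  (m.1, m.2.1, m.2.2.map Fin.val)

theorem mixedTable_getD (x : Fin nf) (w : Fin nw) :
    (h.code.mixedTable.getD x []).getD w 0 = M.mixed x w := by
  have h1 : h.code.mixedTable.getD x [] = List.ofFn fun w => (M.mixed x w : ℕ) := by
    rw [HomCode.mixedTable, OmegaHom.code, List.getD_eq_getElem _ _ (by simp)]
    simp
  rw [h1, List.getD_eq_getElem _ _ (by simp)]
  simp

theorem powTable_getD (x : Fin nf) : h.code.powTable.getD x 0 = M.prod fun _ => x := by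
  rw [HomCode.powTable, OmegaHom.code, List.getD_eq_getElem _ _ (by simp)]
  simp

theorem phaseStep_iff {T : List ℕ × List ℕ} {f : Fin k → Fin nf} {w : List (Fin k)}
    {m m' : ℕ × Fin nf × Option (Fin nf)} :
    phaseStep h.code T (valTable f) (w.map Fin.val) (codePhase m) (codePhase m') = true ↔
      PhaseStep M (targetSets nf nw T) (fun acc => evalFrom M.mul f acc w) m m' := by
  have hsome : ∀ x : Fin nf, evalTable h.code.mulTable (valTable f) (some (x : ℕ))
      (w.map Fin.val) = (evalFrom M.mul f (some x) w).map Fin.val :=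
    fun x => evalTable_eq M.mul f (some x) w
  have hopt : ∀ o : Option (Fin nf), evalTable h.code.mulTable (valTable f) (o.map Fin.val)
      (w.map Fin.val) = (evalFrom M.mul f o w).map Fin.val := fun o => evalTable_eq M.mul f o w
  have hinj := Option.map_injective (Fin.val_injective (n := nf))
  obtain ⟨t, e, o⟩ := m
  obtain ⟨t', e', o'⟩ := m'
  simp only [phaseStep, Bool.or_eq_true, Bool.and_eq_true, decide_eq_true_eq]
  simp only [PhaseStep, codePhase, hsome, hopt, or_assoc, and_assoc, Fin.val_inj, hinj.eq_iff, targetSets, Set.mem_ofPred_eq,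
    List.map_eq_nil_iff, evalFrom_none_eq_none_iff, Option.map_eq_none_iff]
  refine or_congr ?_ (or_congr Iff.rfl (or_congr ?_ (or_congr Iff.rfl ?_)))
  · refine and_congr_right fun _ => and_congr_right fun _ => ?_
    exact hinj.eq_iff (a := some e')
  · refine and_congr_right fun _ => and_congr_right fun _ => and_congr_right fun _ => ?_
    obtain ⟨p, hp⟩ := Option.isSome_iff_exists.1 (evalFrom_some_isSome M.mul f e w)
    rw [hp, Option.map_some, Option.getD_some, powTable_getD, mixedTable_getD]
    simp
  · refine and_congr_right fun _ => and_congr_right fun _ => and_congr_right fun _ =>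
      and_congr_right fun _ => ?_
    exact hinj.eq_iff (b := some e)

theorem mem_evalStates {x : EvalState} : x ∈ evalStates h.code ↔
    ∃ (f : Fin k → Fin nf) (a : Fin k) (m : ℕ × Fin nf × Option (Fin nf)), m.1 < 4 ∧
      x = (valTable f, (a : ℕ), codePhase m) := by
  have hopt : ∀ o, o ∈ h.code.optElements ↔ ∃ o' : Option (Fin nf), o'.map Fin.val = o := by
    intro o
    rw [HomCode.optElements, List.mem_cons, List.mem_map]
    constructor
    · rintro (rfl | ⟨y, hy, rfl⟩)
      · exact ⟨none, rfl⟩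
      · exact ⟨some ⟨y, List.mem_range.1 hy⟩, rfl⟩
    · rintro ⟨_ | y, rfl⟩
      · exact Or.inl rfl
      · exact Or.inr ⟨y, List.mem_range.2 y.2, rfl⟩
  simp only [evalStates, List.mem_flatMap, List.mem_map, List.mem_range, hopt]
  constructor
  · rintro ⟨f, hf, a, ha, t, ht, e, he, _, ⟨o, rfl⟩, rfl⟩
    obtain ⟨f, rfl⟩ := mem_assignments_iff (k := k) (nf := nf).1 hf
    exact ⟨f, ⟨a, ha⟩, (t, ⟨e, he⟩, o), ht, rfl⟩
  · rintro ⟨f, a, m, hm, rfl⟩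
    exact ⟨_, mem_assignments_iff (k := k) (nf := nf).2 ⟨f, rfl⟩, a, a.2, m.1, hm, m.2.1, m.2.1.2, _,
      ⟨m.2.2, rfl⟩, rfl⟩

theorem Substitution.code_getD (σ : Substitution (Fin k)) (a : Fin k) :
    σ.code.getD a [] = (σ.image a).map Fin.val := by
  rw [Substitution.code, List.getD_eq_getElem _ _ (by simp)]
  simp

theorem valTable_injective : Function.Injective (valTable (k := k) (nf := nf)) := by
  intro f g hfg
  funext a
  exact Fin.ext (congrFun (List.ofFn_inj.1 hfg) a)

theorem map_code_evalTable (σ : Substitution (Fin k)) (f : Fin k → Fin nf) :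
    (σ.code.map fun w => (evalTable h.code.mulTable (valTable f) none w).getD 0) =
      valTable fun b => M.wordVal f ⟨σ.image b, σ.image_ne_nil b⟩ := by
  rw [Substitution.code, List.map_ofFn, valTable]
  congr 1
  funext b
  have h1 := evalTable_eq M.mul f none (σ.image b)
  rw [← M.some_wordVal f ⟨σ.image b, σ.image_ne_nil b⟩] at h1
  exact congrArg (Option.getD · 0) h1

theorem evalStep_iff {T : List ℕ × List ℕ} {f f' : Fin k → Fin nf} {a a' : Fin k}
    {m m' : ℕ × Fin nf × Option (Fin nf)} (σ : Substitution (Fin k)) (c : Fin k) :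
    evalStep h.code T (valTable f, (a : ℕ), codePhase m) (σ.code, (c : ℕ))
      (valTable f', (a' : ℕ), codePhase m') = true ↔
    (σ.image c).head? = some a ∧ f' = (fun b => M.wordVal f ⟨σ.image b, σ.image_ne_nil b⟩) ∧
      a' = c ∧ PhaseStep M (targetSets nf nw T)
        (fun acc => evalFrom M.mul f acc (σ.image c).tail) m m' := by
  simp only [evalStep, Bool.and_eq_true, decide_eq_true_eq, Substitution.code_getD, List.head?_map,
    map_code_evalTable, ← List.map_tail, phaseStep_iff, valTable_injective.eq_iff, Fin.val_inj,
    and_assoc]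
  refine and_congr_left fun _ => ?_
  exact (Option.map_injective Fin.val_injective).eq_iff (b := some a)

theorem evalInit_iff {f : Fin k → Fin nf} {a : Fin k} {m : ℕ × Fin nf × Option (Fin nf)} :
    evalInit h.code (valTable f, (a : ℕ), codePhase m) = true ↔
      f = h.letter ∧ m.1 = 0 ∧ m.2.1 = h.letter a := by
  have h1 : h.code.letters = valTable h.letter := rfl
  simp only [evalInit, h1, Bool.and_eq_true, decide_eq_true_eq]
  simp only [codePhase, valTable_getD, valTable_injective.eq_iff, Fin.val_inj, and_assoc]

theorem evalAutomaton_accepts {P : Type} (T : List ℕ × List ℕ) (S : List SubstCode)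
    (sub : P → Substitution (Fin k)) (hS : ∀ p, (sub p).code ∈ S) (s : ℕ → P × Fin k) :
    ((evalAutomaton h.code T S).automaton
        (fun p : P × Fin k => ((sub p.1).code, (p.2 : ℕ)))).Accepts s ↔
      GeneratesValue h (targetSets nf nw T) fun n => (sub (s n).1, (s n).2) := by
  have hmem : ∀ n, ((sub (s n).1).code, ((s n).2 : ℕ)) ∈
      S.flatMap fun s => (List.range h.code.letterCount).map fun a => (s, a) := fun n =>
    List.mem_flatMap.2 ⟨_, hS _, List.mem_map.2 ⟨_, List.mem_range.2 (s n).2.2, rfl⟩⟩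
  rw [evalAutomaton, buchiOf_accepts (fun p : P × Fin k => ((sub p.1).code, (p.2 : ℕ))) s hmem]
  constructor
  · rintro ⟨x, h1, h2, h3, h4⟩
    choose f a m hm hx using fun n => (mem_evalStates h).1 (h2 n)
    have h3' : ∀ n, _ := fun n => by
      have := h3 n
      rw [hx n, hx (n + 1)] at this
      exact (evalStep_iff h (sub (s n).1) (s n).2).1 this
    rw [hx 0, evalInit_iff] at h1
    have hf : ∀ n, f n = letterValues h (fun i => sub (s i).1) n := by
      intro n
      induction n with
      | zero => exact h1.1
      | succ n ih => rw [(h3' n).2.1, ih]; rfl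
    refine ⟨congenial_iff.2 fun n => ?_, a 0, (h3' 0).1, m, h1.2.1, h1.2.2, fun n => ?_,
      fun N => ?_⟩
    · rw [(h3' (n + 1)).1, (h3' n).2.2.1]
    · have h5 := (h3' n).2.2.2
      rw [hf n] at h5
      exact h5
    · obtain ⟨n, hn, hacc⟩ := h4 N
      refine ⟨n, hn, ?_⟩
      rw [hx n] at hacc
      simp only [evalAcc, Bool.or_eq_true, decide_eq_true_eq] at hacc
      exact hacc
  · rintro ⟨hs, b, hb, m, hm0, hmx, hm, hacc⟩
    set f := letterValues h fun i => sub (s i).1 with hf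
    set a : ℕ → Fin k := fun n => Nat.casesOn n b fun j => (s j).2 with ha
    have hm4 : ∀ n, (m n).1 < 4 := by
      intro n
      cases n with
      | zero => omega
      | succ n =>
        rcases hm n with ⟨-, h2, -⟩ | ⟨-, h2, -⟩ | ⟨-, h2, -⟩ | ⟨-, h2, -⟩ | ⟨-, h2, -⟩ <;> omega
    refine ⟨fun n => (valTable (f n), (a n : ℕ), codePhase (m n)), ?_, fun n => ?_, fun n => ?_,
      fun N => ?_⟩
    · exact (evalInit_iff h).2 ⟨rfl, hm0, hmx⟩
    · exact (mem_evalStates h).2 ⟨_, _, _, hm4 n, rfl⟩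
    · refine (evalStep_iff h (sub (s n).1) (s n).2).2 ⟨?_, rfl, rfl, hm n⟩
      cases n with
      | zero => exact hb
      | succ n => exact congenial_iff.1 hs n
    · obtain ⟨n, hn, h1⟩ := hacc N
      refine ⟨n, hn, ?_⟩
      simp only [evalAcc, Bool.or_eq_true, decide_eq_true_eq]
      exact h1

theorem langTargets_iff {H : Finset (Fin nw)} {L : Set (ℕ → Fin k)}
    (hL : Recognises h (H : Set (Fin nw)) L) (s : ℕ → Substitution (Fin k) × Fin k) :
    GeneratesValue h (targetSets nf nw (langTargets (h.code, finsetCode H))) s ↔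
      Congenial s ∧ ∃ α ∈ L, Generates s (Sum.inr α) := by
  rw [generatesValue_iff]
  refine and_congr_right fun _ => ?_
  have hT : ∀ w : Fin nw, (w : ℕ) ∈ (langTargets (h.code, finsetCode H)).2 ↔ w ∈ H := by
    intro w
    have h1 : (finsetCode H).getD w false = decide (w ∈ H) := by
      rw [finsetCode, List.getD_eq_getElem _ _ (by simp)]
      simp
    rw [langTargets, List.mem_filter, h1, decide_eq_true_eq, List.mem_range]
    exact and_iff_right w.2
  constructor
  · rintro ⟨v | β, h1, h2⟩
    · exact absurd h2 List.not_mem_nil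
    · exact ⟨β, (hL β).2 ((hT _).1 h2), h1⟩
  · rintro ⟨β, hβ, h1⟩
    exact ⟨Sum.inr β, h1, (hT _).2 ((hL β).1 hβ)⟩

theorem elementTargets_iff (x : Fin nf ⊕ Fin nw) (s : ℕ → Substitution (Fin k) × Fin k) :
    GeneratesValue h (targetSets nf nw (elementTargets (sumCode x))) s ↔
      Congenial s ∧ ∃ α, Generates s α ∧ h.app α = x := by
  rw [generatesValue_iff]
  refine and_congr_right fun _ => exists_congr fun α => and_congr_right fun _ => ?_
  rcases x with x | x <;> rcases h.app α with y | y <;>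
    simp [targetSets, elementTargets, sumCode, Fin.val_inj]

theorem generatesValue_trace (rep : Xi (Fin k) M → Substitution (Fin k))
    (hrep : ∀ ξ, (rep ξ).cls M = ξ) (T : Set (Fin nf) × Set (Fin nw))
    (s : ℕ → Substitution (Fin k) × Fin k) :
    GeneratesValue h T (fun n => (rep (trace M s n).1, (trace M s n).2)) ↔
      GeneratesValue h T s := by
  refine generatesValue_congr h (fun n => rfl) fun n a f => head_tail_of_equiv ?_ a f
  exact Quotient.exact (hrep ((s n).1.cls M))

end

theorem mainTheorem2 :
    ∃ (toHom : ℕ × BuchiCode ℕ → HomCode × List Bool)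
      (reps : HomCode → List SubstCode)
      (autL : HomCode × List Bool → BuchiCode (SubstCode × ℕ))
      (autX : HomCode × (ℕ ⊕ ℕ) → BuchiCode (SubstCode × ℕ))
      (autS : (HomCode × List Bool) × List SubstCode → BuchiCode (SubstCode × ℕ)),
      Computable toHom ∧ Computable reps ∧ Computable autL ∧ Computable autX ∧ Computable autS ∧
      -- from a Büchi automaton, compute a finite ω-semigroup recognising its language
      (∀ (k : ℕ) (c : BuchiCode ℕ), 0 < k →
        ∃ (nf nw : ℕ) (M : OmegaSemigroup (Fin nf) (Fin nw)) (h : WordHom (Fin k) M)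
          (H : Finset (Fin nw)),
          toHom (k, c) = (h.code, finsetCode H) ∧
          Recognises h (H : Set (Fin nw))
            {α : ℕ → Fin k | (c.automaton (fun a : Fin k => (a : ℕ))).Accepts α}) ∧
      -- for every finite ω-semigroup `M` and every language `L` recognised by it
      (∀ (k nf nw : ℕ) (M : OmegaSemigroup (Fin nf) (Fin nw)) (h : WordHom (Fin k) M)
        (H : Finset (Fin nw)) (L : Set (ℕ → Fin k)), 0 < k →
        Recognises h (H : Set (Fin nw)) L →
        -- representatives of the classes, used as letters of the computed automata
        (∃ rep : Xi (Fin k) M → Substitution (Fin k),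
          (∀ ξ, (rep ξ).cls M = ξ) ∧
          (reps h.code).Nodup ∧
          (∀ w, w ∈ reps h.code ↔ ∃ ξ, (rep ξ).code = w) ∧
          (∀ s : ℕ → Substitution (Fin k) × Fin k,
            ((autL (h.code, finsetCode H)).automaton
              (fun p : Xi (Fin k) M × Fin k => ((rep p.1).code, (p.2 : ℕ)))).Accepts (trace M s) ↔
            Congenial s ∧ ∃ α ∈ L, Generates s (Sum.inr α)) ∧
          (∀ (x : Fin nf ⊕ Fin nw) (s : ℕ → Substitution (Fin k) × Fin k),
            ((autX (h.code, sumCode x)).automaton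
              (fun p : Xi (Fin k) M × Fin k => ((rep p.1).code, (p.2 : ℕ)))).Accepts (trace M s) ↔
            Congenial s ∧ ∃ α, Generates s α ∧ h.app α = x)) ∧
        -- a finite set `S` of substitutions
        (∀ (S : List (Substitution (Fin k))) (s : ℕ → {σ // σ ∈ S} × Fin k),
          ((autS ((h.code, finsetCode H), S.map Substitution.code)).automaton
            (fun p : {σ // σ ∈ S} × Fin k => (p.1.1.code, (p.2 : ℕ)))).Accepts s ↔
          Congenial (fun n => ((s n).1.1, (s n).2)) ∧
            ∃ α ∈ L, Generates (fun n => ((s n).1.1, (s n).2)) (Sum.inr α))) := by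
  refine ⟨automatonHom, HomCode.representatives, langAutomaton, elementAutomaton, substAutomaton,
    automatonHom_primrec.to_comp, (HomCode.representatives_primrec Primrec.id).to_comp,
    langAutomaton_primrec.to_comp, elementAutomaton_primrec.to_comp,
    substAutomaton_primrec.to_comp, fun k c _ => automatonHom_spec k c, ?_⟩
  intro k nf nw M h H L _ hL
  refine ⟨?_, fun S s => ?_⟩
  · obtain ⟨rep, h1, h2, h3⟩ := representatives_spec h
    refine ⟨rep, h1, h2, h3, fun s => ?_, fun x s => ?_⟩
    · rw [langAutomaton, evalAutomaton_accepts h _ _ rep fun ξ => (h3 _).2 ⟨ξ, rfl⟩,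
        generatesValue_trace h rep h1, langTargets_iff h hL]
    · rw [elementAutomaton, evalAutomaton_accepts h _ _ rep fun ξ => (h3 _).2 ⟨ξ, rfl⟩,
        generatesValue_trace h rep h1, elementTargets_iff]
  · rw [substAutomaton, evalAutomaton_accepts h _ _ (fun p : {σ // σ ∈ S} => p.1)
      fun p => List.mem_map.2 ⟨p.1, p.2, rfl⟩, langTargets_iff h hL]
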